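/- A random vector $Y$ in $\mathbb{R}^m$ is called $\sigma$-subgaussian if $\mathbb{E}\big[e^{\langle\theta,Y\rangle}\big]\le e^{(\sigma^2/2)\|\theta\|_2^2}$ for every $\theta\in\mathbb{R}^m$. **Theorem (Gram-Schmidt Walk).** There is a polynomial-time randomized algorithm that, given as input vectors $v_1,\dots,v_n\in\mathbb{R}^m$ of $\ell_2$ norm at most $1$ and $x_0\in[-1,1]^n$, outputs a coloring $x\in\{-1,1\}^n$ such that the random vector $\sum_{i=1}^n (x(i)-x_0(i))\,v_i$ is $\sigma$-subgaussian with $\sigma=\sqrt{40}$. Here an algorithm is a single program, not depending on $n$ and $m$, for a random-access machine with exact real arithmetic; its elementary steps are the operations $+,-,\times,/$ and comparisons on real numbers, additions, subtractions and comparisons of indices, and tosses of a coin whose bias is a real number that the program has computed. Polynomial time means that there is a polynomial $p$ with natural-number coefficients such that for all $n,m$ and all inputs as above the program halts after at most $p(n+m)$ steps, whatever the outcomes of the coin tosses are. -/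

import Mathlib

open MeasureTheory

noncomputable section

/-- A random vector `Y` in `ℝ^m` on `(Ω, P)` is `σ`-subgaussian if for every `θ` the exponential
moment of `⟨θ, Y⟩` exists and is at most `exp ((σ ^ 2 / 2) * ‖θ‖ ^ 2)`. -/
def IsSubgaussian {Ω : Type*} [MeasurableSpace Ω] {m : ℕ}
    (Y : Ω → EuclideanSpace ℝ (Fin m)) (σ : ℝ) (P : Measure Ω) : Prop :=
  ∀ θ : EuclideanSpace ℝ (Fin m),
    Integrable (fun ω => Real.exp (inner ℝ θ (Y ω))) P ∧
      ∫ ω, Real.exp (inner ℝ θ (Y ω)) ∂P ≤ Real.exp (σ ^ 2 / 2 * ‖θ‖ ^ 2)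

/-! A randomized real random-access machine: index registers hold natural numbers, and the cells
of finitely many two-dimensional arrays hold real numbers.  A program is a finite text that does
not depend on the size of the input.  Every elementary instruction is executed in one step:
exact real arithmetic and comparison, addition and truncated subtraction of indices, and the toss
of a coin whose bias is the content of a real cell. -/

namespace RealRAM

/-- A reference to a cell of array number `arr`; its row and column are the current contents of
the index registers `row` and `col`. -/
structure Ref where
  arr : ℕ
  row : ℕ
  col : ℕ

/-- The four arithmetic operations (with the convention `x / 0 = 0`). -/
inductive ArithOp
  | add | sub | mul | div

def ArithOp.eval : ArithOp → ℝ → ℝ → ℝ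
  | .add, x, y => x + y
  | .sub, x, y => x - y
  | .mul, x, y => x * y
  | .div, x, y => x / y

/-- Tests: comparison of two index registers, or of two real cells. -/
inductive Test
  | idxLt (i j : ℕ)
  | realLt (x y : Ref)

/-- Programs.  The only constants that may occur in them are integers. -/
inductive Prog
  | skip
  /-- register `k` gets the constant `c` -/
  | idxConst (k c : ℕ)
  /-- register `k` gets the sum of registers `i` and `j` -/
  | idxAdd (k i j : ℕ)
  /-- register `k` gets the truncated difference of registers `i` and `j` -/
  | idxSub (k i j : ℕ)
  /-- cell `z` gets the constant `c` -/
  | realConst (z : Ref) (c : ℤ)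
  /-- cell `z` gets the result of the operation on cells `x` and `y` -/
  | realOp (op : ArithOp) (z x y : Ref)
  /-- register `k` gets `1` with the probability that is stored in cell `x`, and `0` otherwise -/
  | toss (k : ℕ) (x : Ref)
  | seq (a b : Prog)
  | ite (t : Test) (a b : Prog)
  | whileDo (t : Test) (a : Prog)

/-- The memory of the machine. -/
structure Memory where
  idx : ℕ → ℕ
  cell : ℕ → ℕ → ℕ → ℝ

def Memory.get (s : Memory) (x : Ref) : ℝ := s.cell x.arr (s.idx x.row) (s.idx x.col)

def Memory.setIdx (s : Memory) (k c : ℕ) : Memory :=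
  { s with idx := Function.update s.idx k c }

def Memory.set (s : Memory) (x : Ref) (r : ℝ) : Memory :=
  { s with cell := fun a i j =>
      if a = x.arr ∧ i = s.idx x.row ∧ j = s.idx x.col then r else s.cell a i j }

def Test.Holds (s : Memory) : Test → Prop
  | .idxLt i j => s.idx i < s.idx j
  | .realLt x y => s.get x < s.get y

/-- A coin that shows `true` with probability `p` (truncated to the interval `[0, 1]`). -/
def coin (p : ℝ) : PMF Bool :=
  PMF.ofFintype
    (fun b => if b then min 1 (ENNReal.ofReal p) else 1 - min 1 (ENNReal.ofReal p))
    (by simp [add_tsub_cancel_of_le])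

/-- A configuration: the list of the programs that are still to be executed, one after the other,
and the memory.  The machine has halted when this list is empty. -/
abbrev Config := List Prog × Memory

open Classical in
/-- One step of the machine.  A configuration that has halted does not change any more. -/
def step : Config → PMF Config
  | ([], s) => PMF.pure ([], s)
  | (.skip :: K, s) => PMF.pure (K, s)
  | (.idxConst k c :: K, s) => PMF.pure (K, s.setIdx k c)
  | (.idxAdd k i j :: K, s) => PMF.pure (K, s.setIdx k (s.idx i + s.idx j))
  | (.idxSub k i j :: K, s) => PMF.pure (K, s.setIdx k (s.idx i - s.idx j))
  | (.realConst z c :: K, s) => PMF.pure (K, s.set z c)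
  | (.realOp op z x y :: K, s) => PMF.pure (K, s.set z (op.eval (s.get x) (s.get y)))
  | (.toss k x :: K, s) => (coin (s.get x)).map fun b => (K, s.setIdx k (if b then 1 else 0))
  | (.seq a b :: K, s) => PMF.pure (a :: b :: K, s)
  | (.ite t a b :: K, s) => PMF.pure (if t.Holds s then (a :: K, s) else (b :: K, s))
  | (.whileDo t a :: K, s) =>
      PMF.pure (if t.Holds s then (a :: .whileDo t a :: K, s) else (K, s))

/-- The distribution of the configuration after `T` steps. -/
def run : ℕ → Config → PMF Config
  | 0, c => PMF.pure c
  | T + 1, c => (step c).bind (run T)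

/-- The initial memory: index registers `0` and `1` hold `n` and `m`, array `0` holds the vectors
`v 0, …, v (n - 1)` as its rows, array `1` holds `x₀` as its column `0`, and everything else
is `0`. -/
def initial {n m : ℕ} (v : Fin n → EuclideanSpace ℝ (Fin m)) (x₀ : Fin n → ℝ) : Memory where
  idx k := if k = 0 then n else if k = 1 then m else 0
  cell a i j :=
    if a = 0 then (if h : i < n ∧ j < m then v ⟨i, h.1⟩ ⟨j, h.2⟩ else 0)
    else if a = 1 then (if h : i < n ∧ j = 0 then x₀ ⟨i, h.1⟩ else 0)
    else 0

/-- The distribution of the configuration after `T` steps of the program `A` on the input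
`v`, `x₀`. -/
def runOn (A : Prog) {n m : ℕ} (v : Fin n → EuclideanSpace ℝ (Fin m)) (x₀ : Fin n → ℝ)
    (T : ℕ) : PMF Config :=
  run T ([A], initial v x₀)

/-- On the input `v`, `x₀`, the program `A` halts after at most `T` steps, whatever the outcomes
of the coin tosses are. -/
def HaltsWithin (A : Prog) {n m : ℕ} (v : Fin n → EuclideanSpace ℝ (Fin m)) (x₀ : Fin n → ℝ)
    (T : ℕ) : Prop :=
  ∀ c ∈ (runOn A v x₀ T).support, c.1 = []

/-- The distribution of the first `n` entries of column `0` of array `2` after `T` steps.  If the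
program halts within `T` steps, this is the distribution of its output. -/
def outputLaw (A : Prog) {n m : ℕ} (v : Fin n → EuclideanSpace ℝ (Fin m)) (x₀ : Fin n → ℝ)
    (T : ℕ) : PMF (Fin n → ℝ) :=
  (runOn A v x₀ T).map fun c i => c.2.cell 2 i 0

end RealRAM

end

/-!
The program is the Gram-Schmidt walk.  It keeps a fractional coloring `x`, initially `x₀`, and
calls the last coordinate with `|x i| < 1` the pivot.  In each of `n` rounds it moves `x` along a
direction `u` that is supported on the coordinates that are alive, has the entry `1` at the pivot,
and is such that `w = ∑ i, u i • v i` is the component of the pivot vector that is orthogonal to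
the other alive vectors.  The two extreme feasible step lengths are chosen with the probabilities
that make the step a martingale; either of them freezes a coordinate, so that `n` rounds are
enough.

The output is subgaussian because of a potential.  Fix `θ`, let `U` be the span of the alive
vectors and `a = ⟪θ, w⟫`.  The potential `potential v θ x` is `exp (20 * ‖P_U θ‖ ^ 2)` times the
exponential moment of `a * (X - x p)`, where `X` is a random sign with mean `x p` at the pivot
`p`, times the discount `exp (-20 * a ^ 2)`.  For fixed `U` and `w` it is exactly a martingale
along the walk, after multiplication with the exponential of the displacement
(`pivotPotential_martingale`).  When coordinates freeze, it does not increase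
(`potential_le_of_alive_subset`):
* If the pivot freezes, then `‖P_U θ‖ ^ 2` drops by at least `a ^ 2`, since `‖w‖ ≤ 1`, and this
  pays for the discount.
* If the pivot survives, its residual becomes `w + r` with `r` orthogonal to `w`, and `‖P_U θ‖ ^
  2` drops by at least `-4 * ⟪θ, w⟫ * ⟪θ, r⟫` (`neg_four_mul_inner_mul_inner_le`).  If `a` and
  `⟪θ, r⟫` have the same sign, then the discount pays for the new slope, and otherwise this drop
  does (`pivotPotential_add_le`).

Initially the potential is at most `exp (20 * ‖θ‖ ^ 2)`, and finally it is at least `1`.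

The direction `u` is computed by orthogonalizing the rows `(v i, e i)`, where `e i` is the
standard unit vector and the rows of frozen coordinates are replaced by `0`: the pivot row becomes
`(w, u)`. Rows that vanish need no case distinction, because the machine divides by `0` with
result `0`.

The program is verified by Hoare-style rules with time bounds (`Runs`) for its parts without coin
tosses, and by `expCost`, the expectation of a cost that is `⊤` where the machine has not halted,
for the whole.  A finite bound on `expCost` yields termination, the shape of the output and the
exponential moment at once.
-/

noncomputable section

namespace RealRAM

open scoped ENNReal

/-! ### Expected costs of runs -/

/-- The expected value of `F` at the memory of the configuration that is reached from `c` after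
`T` steps, where a configuration that has not halted counts as `⊤`.  A single finite bound on this
number therefore controls the output law and also forces the machine to halt surely. -/
def expCost (F : Memory → ℝ≥0∞) : ℕ → Config → ℝ≥0∞
  | 0, ([], s) => F s
  | 0, (_ :: _, _) => ⊤
  | T + 1, c => ∑' c', step c c' * expCost F T c'

lemma tsum_pure_mul {α : Type*} (a : α) (g : α → ℝ≥0∞) : ∑' b, PMF.pure a b * g b = g a := by
  rw [tsum_eq_single a (fun b hb => by simp [PMF.pure_apply, hb])]
  simp

lemma tsum_bind_mul {α β : Type*} (μ : PMF α) (k : α → PMF β) (g : β → ℝ≥0∞) :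
    ∑' b, μ.bind k b * g b = ∑' a, μ a * ∑' b, k a b * g b := by
  simp only [PMF.bind_apply, ← ENNReal.tsum_mul_right, ← ENNReal.tsum_mul_left]
  rw [ENNReal.tsum_comm]
  simp only [mul_assoc]

lemma tsum_map_mul {α β : Type*} (μ : PMF α) (f : α → β) (g : β → ℝ≥0∞) :
    ∑' b, μ.map f b * g b = ∑' a, μ a * g (f a) := by
  rw [PMF.map, tsum_bind_mul]
  simp only [Function.comp_apply, tsum_pure_mul]

lemma expCost_eq_tsum (F : Memory → ℝ≥0∞) (T : ℕ) (c : Config) :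
    expCost F T c = ∑' c', run T c c' * expCost F 0 c' := by
  induction T generalizing c with
  | zero => rw [run, tsum_pure_mul]
  | succ T ih =>
    rw [run, tsum_bind_mul, expCost]
    simp only [ih]

lemma expCost_nil (F : Memory → ℝ≥0∞) (T : ℕ) (s : Memory) : expCost F T ([], s) = F s := by
  induction T with
  | zero => rfl
  | succ T ih => rw [expCost, step, tsum_pure_mul, ih]

lemma expCost_succ_le (F : Memory → ℝ≥0∞) (T : ℕ) (c : Config) :
    expCost F (T + 1) c ≤ expCost F T c := by
  induction T generalizing c with
  | zero =>
    obtain ⟨_ | ⟨a, K⟩, s⟩ := c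
    · rw [expCost_nil, expCost_nil]
    · exact le_top
  | succ T ih =>
    rw [expCost, expCost]
    exact ENNReal.tsum_le_tsum fun c' => mul_le_mul_right (ih c') _

lemma expCost_antitone (F : Memory → ℝ≥0∞) (c : Config) : Antitone fun T => expCost F T c :=
  antitone_nat_of_succ_le fun T => expCost_succ_le F T c

/-! ### Executions without coin tosses -/

/-- `BigStep a s s' t`: started with memory `s`, the program `a` tosses no coin, finishes after
exactly `t` steps and leaves the memory `s'`.  There is no rule for the subtraction of indices, which
the walk does not need. -/
inductive BigStep : Prog → Memory → Memory → ℕ → Prop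
  | skip (s) : BigStep .skip s s 1
  | idxConst (k c s) : BigStep (.idxConst k c) s (s.setIdx k c) 1
  | idxAdd (k i j s) : BigStep (.idxAdd k i j) s (s.setIdx k (s.idx i + s.idx j)) 1
  | realConst (z c s) : BigStep (.realConst z c) s (s.set z c) 1
  | realOp (op z x y s) :
      BigStep (.realOp op z x y) s (s.set z (op.eval (s.get x) (s.get y))) 1
  | seq {a b s s₁ s₂ t₁ t₂} :
      BigStep a s s₁ t₁ → BigStep b s₁ s₂ t₂ → BigStep (.seq a b) s s₂ (t₁ + t₂ + 1)
  | iteTrue {c a b s s' t} :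
      Test.Holds s c → BigStep a s s' t → BigStep (.ite c a b) s s' (t + 1)
  | iteFalse {c a b s s' t} :
      ¬ Test.Holds s c → BigStep b s s' t → BigStep (.ite c a b) s s' (t + 1)
  | whileTrue {c a s s₁ s₂ t₁ t₂} :
      Test.Holds s c → BigStep a s s₁ t₁ → BigStep (.whileDo c a) s₁ s₂ t₂ →
        BigStep (.whileDo c a) s s₂ (t₁ + t₂ + 1)
  | whileFalse {c a s} : ¬ Test.Holds s c → BigStep (.whileDo c a) s s 1

lemma BigStep.expCost_eq {a : Prog} {s s' : Memory} {t : ℕ} (h : BigStep a s s' t)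
    (F : Memory → ℝ≥0∞) (K : List Prog) (T : ℕ) :
    expCost F (T + t) (a :: K, s) = expCost F T (K, s') := by
  induction h generalizing K T with
  | skip | idxConst | idxAdd | realConst | realOp => rw [expCost, step, tsum_pure_mul]
  | @seq a b s s₁ s₂ t₁ t₂ _ _ iha ihb =>
    rw [← add_assoc, expCost, step, tsum_pure_mul, add_comm t₁, ← add_assoc, iha, ihb]
  | iteTrue hc _ ih => rw [← add_assoc, expCost, step, tsum_pure_mul, if_pos hc, ih]
  | iteFalse hc _ ih => rw [← add_assoc, expCost, step, tsum_pure_mul, if_neg hc, ih]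
  | @whileTrue c a s s₁ s₂ t₁ t₂ hc _ _ iha ihb =>
    rw [← add_assoc, expCost, step, tsum_pure_mul, if_pos hc, add_comm t₁, ← add_assoc, iha, ihb]
  | whileFalse hc => rw [expCost, step, tsum_pure_mul, if_neg hc]

/-- Whether the text of a program contains an assignment to the index register `r`. -/
def Prog.writesIdx : Prog → ℕ → Bool
  | .skip, _ | .realConst _ _, _ | .realOp _ _ _ _, _ => false
  | .idxConst k _, r | .idxAdd k _ _, r | .idxSub k _ _, r | .toss k _, r => k == r
  | .seq a b, r | .ite _ a b, r => a.writesIdx r || b.writesIdx r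
  | .whileDo _ a, r => a.writesIdx r

/-- Whether the text of a program contains an assignment to a cell of array number `x`. -/
def Prog.writesArr : Prog → ℕ → Bool
  | .skip, _ | .idxConst _ _, _ | .idxAdd _ _ _, _ | .idxSub _ _ _, _ | .toss _ _, _ => false
  | .realConst z _, x | .realOp _ z _ _, x => z.arr == x
  | .seq a b, x | .ite _ a b, x => a.writesArr x || b.writesArr x
  | .whileDo _ a, x => a.writesArr x

/-- The memories `s` and `s'` agree on all registers and arrays that `a` does not write to. -/
structure Agree (a : Prog) (s s' : Memory) : Prop where
  idx : ∀ r, a.writesIdx r = false → s'.idx r = s.idx r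
  cell : ∀ x, a.writesArr x = false → s'.cell x = s.cell x

lemma Agree.refl (a : Prog) (s : Memory) : Agree a s s := ⟨fun _ _ => rfl, fun _ _ => rfl⟩

lemma Agree.trans {a : Prog} {s s₁ s₂ : Memory} (h : Agree a s s₁) (h' : Agree a s₁ s₂) :
    Agree a s s₂ :=
  ⟨fun r hr => (h'.idx r hr).trans (h.idx r hr), fun x hx => (h'.cell x hx).trans (h.cell x hx)⟩

lemma Agree.mono {a b : Prog} {s s' : Memory} (h : Agree a s s')
    (hi : ∀ r, b.writesIdx r = false → a.writesIdx r = false)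
    (hc : ∀ x, b.writesArr x = false → a.writesArr x = false) : Agree b s s' :=
  ⟨fun r hr => h.idx r (hi r hr), fun x hx => h.cell x (hc x hx)⟩

lemma agree_setIdx {a : Prog} {k : ℕ} (hk : a.writesIdx k = true) (s : Memory) (c : ℕ) :
    Agree a s (s.setIdx k c) := by
  refine ⟨fun r hr => ?_, fun x _ => rfl⟩
  have : r ≠ k := by rintro rfl; simp_all
  simp [Memory.setIdx, this]

lemma agree_set {a : Prog} {z : Ref} (hz : a.writesArr z.arr = true) (s : Memory) (c : ℝ) :
    Agree a s (s.set z c) := by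
  refine ⟨fun r _ => rfl, fun x hx => ?_⟩
  have : x ≠ z.arr := by rintro rfl; simp_all
  funext i j
  simp [Memory.set, this]

lemma BigStep.agree {a : Prog} {s s' : Memory} {t : ℕ} (h : BigStep a s s' t) :
    Agree a s s' := by
  induction h with
  | skip => exact Agree.refl _ _
  | idxConst | idxAdd => exact agree_setIdx (by simp [Prog.writesIdx]) _ _
  | realConst | realOp => exact agree_set (by simp [Prog.writesArr]) _ _
  | seq _ _ iha ihb =>
    exact (iha.mono (by simp +contextual [Prog.writesIdx])
      (by simp +contextual [Prog.writesArr])).trans (ihb.mono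
        (by simp +contextual [Prog.writesIdx]) (by simp +contextual [Prog.writesArr]))
  | iteTrue _ _ ih | iteFalse _ _ ih =>
    exact ih.mono (by simp +contextual [Prog.writesIdx]) (by simp +contextual [Prog.writesArr])
  | @whileTrue c a _ _ _ _ _ _ _ _ iha ihb =>
    exact (iha.mono (b := .whileDo c a) (fun _ => id) (fun _ => id)).trans ihb
  | whileFalse => exact Agree.refl _ _

/-! ### Total correctness with time bounds -/

/-- Started with memory `s`, the program `a` tosses no coin, finishes after at most `B` steps, and
leaves a memory that satisfies `Q`. -/
def Runs (a : Prog) (s : Memory) (B : ℕ) (Q : Memory → Prop) : Prop :=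
  ∃ s' t, BigStep a s s' t ∧ t ≤ B ∧ Q s'

lemma Runs.exists_expCost_le {a : Prog} {s : Memory} {B : ℕ} {Q : Memory → Prop}
    (h : Runs a s B Q) : ∃ s', Q s' ∧ ∀ (F : Memory → ℝ≥0∞) (K : List Prog) (T : ℕ),
      expCost F (T + B) (a :: K, s) ≤ expCost F T (K, s') := by
  obtain ⟨s', t, h, ht, hQ⟩ := h
  refine ⟨s', hQ, fun F K T => ?_⟩
  rw [← h.expCost_eq]
  exact expCost_antitone F _ (by lia)

lemma Runs.mono {a : Prog} {s : Memory} {B B' : ℕ} {Q Q' : Memory → Prop} (h : Runs a s B Q)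
    (hB : B ≤ B') (hQ : ∀ s', Agree a s s' → Q s' → Q' s') : Runs a s B' Q' := by
  obtain ⟨s', t, h, ht, hq⟩ := h
  exact ⟨s', t, h, ht.trans hB, hQ s' h.agree hq⟩

lemma Runs.seq {a b : Prog} {s : Memory} {B₁ B₂ B : ℕ} {Q : Memory → Prop}
    (h : Runs a s B₁ fun s₁ => Runs b s₁ B₂ Q) (hB : B₁ + B₂ + 1 ≤ B) :
    Runs (.seq a b) s B Q := by
  obtain ⟨s₁, t₁, ha, ht₁, s₂, t₂, hb, ht₂, hQ⟩ := h
  exact ⟨s₂, _, ha.seq hb, by lia, hQ⟩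

/-- The programs that consist of a single deterministic assignment. -/
def Prog.IsAssign : Prog → Prop
  | .skip | .idxConst _ _ | .idxAdd _ _ _ | .realConst _ _ | .realOp _ _ _ _ => True
  | _ => False

/-- The effect of a deterministic assignment. -/
def Prog.assign : Prog → Memory → Memory
  | .idxConst k c, s => s.setIdx k c
  | .idxAdd k i j, s => s.setIdx k (s.idx i + s.idx j)
  | .realConst z c, s => s.set z c
  | .realOp op z x y, s => s.set z (op.eval (s.get x) (s.get y))
  | _, s => s

lemma Prog.IsAssign.bigStep {a : Prog} (ha : a.IsAssign) (s : Memory) :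
    BigStep a s (a.assign s) 1 := by
  cases a <;> first | exact ha.elim | constructor

lemma Runs.assign {a : Prog} {s : Memory} {Q : Memory → Prop} {B : ℕ} (ha : a.IsAssign)
    (hQ : Q (a.assign s)) : Runs a s (B + 1) Q :=
  ⟨_, _, ha.bigStep s, by lia, hQ⟩

lemma Runs.assign_seq {a b : Prog} {s : Memory} {Q : Memory → Prop} {B : ℕ} (ha : a.IsAssign)
    (h : Runs b (a.assign s) B Q) : Runs (.seq a b) s (B + 2) Q :=
  Runs.seq (Runs.assign (B := 0) ha h) (by lia)

lemma Runs.ite {c : Test} {a b : Prog} {s : Memory} {Q : Memory → Prop} {B : ℕ}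
    (ha : c.Holds s → Runs a s B Q) (hb : ¬ c.Holds s → Runs b s B Q) :
    Runs (.ite c a b) s (B + 1) Q := by
  by_cases hc : c.Holds s
  · obtain ⟨s', t, h, ht, hQ⟩ := ha hc
    exact ⟨s', _, h.iteTrue hc, by lia, hQ⟩
  · obtain ⟨s', t, h, ht, hQ⟩ := hb hc
    exact ⟨s', _, h.iteFalse hc, by lia, hQ⟩

/-- `for k in 0, …, N - 1 do a`, where `k` and `N` are registers and register `4` holds `1`. -/
def forDo (k N : ℕ) (a : Prog) : Prog :=
  .seq (.idxConst k 0) (.whileDo (.idxLt k N) (.seq a (.idxAdd k k 4)))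

/-- The invariant rule for counting loops.  By `Agree`, the invariant `I` need not mention what the
loop does not write to. -/
lemma Runs.forDo {k N : ℕ} {a : Prog} {s : Memory} {B : ℕ} (I : ℕ → Memory → Prop)
    (hkN : k ≠ N) (hk4 : k ≠ 4)
    (hk : a.writesIdx k = false) (hN : a.writesIdx N = false) (h4 : a.writesIdx 4 = false)
    (hs4 : s.idx 4 = 1) (h0 : I 0 (s.setIdx k 0))
    (hstep : ∀ i < s.idx N, ∀ s', I i s' → s'.idx k = i → Agree (RealRAM.forDo k N a) s s' →
      Runs a s' B fun s'' => I (i + 1) (s''.setIdx k (i + 1))) :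
    Runs (RealRAM.forDo k N a) s ((B + 3) * s.idx N + 3) (I (s.idx N)) := by
  have main : ∀ d i s', i + d = s.idx N → I i s' → s'.idx k = i →
      Agree (RealRAM.forDo k N a) s s' →
      Runs (.whileDo (.idxLt k N) (.seq a (.idxAdd k k 4))) s' ((B + 3) * d + 1)
        (I (s.idx N)) := by
    intro d
    induction d with
    | zero =>
      intro i s' hi hI hki hA
      refine ⟨s', 1, .whileFalse ?_, by lia, by rwa [← hi]⟩
      have : s'.idx N = s.idx N := hA.idx N (by simp [RealRAM.forDo, Prog.writesIdx, hN, hkN])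
      simp only [Test.Holds]
      lia
    | succ d ih =>
      intro i s' hi hI hki hA
      have hsN : s'.idx N = s.idx N := hA.idx N (by simp [RealRAM.forDo, Prog.writesIdx, hN, hkN])
      have hs'4 : s'.idx 4 = 1 :=
        (hA.idx 4 (by simp [RealRAM.forDo, Prog.writesIdx, h4, hk4])).trans hs4
      obtain ⟨s₁, t₁, h₁, ht₁, hI₁⟩ := hstep i (by lia) s' hI hki hA
      have e : s₁.idx k + s₁.idx 4 = i + 1 := by
        rw [h₁.agree.idx k hk, h₁.agree.idx 4 h4, hki, hs'4]
      have hb : BigStep (.seq a (.idxAdd k k 4)) s' (s₁.setIdx k (i + 1)) (t₁ + 1 + 1) := by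
        rw [← e]
        exact h₁.seq (.idxAdd k k 4 s₁)
      obtain ⟨s₂, t₂, h₂, ht₂, hI₂⟩ := ih (i + 1) _ (by lia) hI₁ (by simp [Memory.setIdx])
        (hA.trans (hb.agree.mono (by simp +contextual [RealRAM.forDo, Prog.writesIdx])
          (by simp +contextual [RealRAM.forDo, Prog.writesArr])))
      refine ⟨s₂, _, .whileTrue ?_ hb h₂, by lia, hI₂⟩
      simp only [Test.Holds]
      lia
  refine Runs.seq (Runs.assign (B := 0) trivial ?_) (B₂ := (B + 3) * s.idx N + 1) (by lia)
  exact main _ 0 _ (by lia) h0 (by simp [Prog.assign, Memory.setIdx])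
    (agree_setIdx (by simp [RealRAM.forDo, Prog.writesIdx]) _ _)

end RealRAM

namespace GramSchmidtWalk

/-! ### The moment generating function of a sign -/

/-- The moment generating function, at `a`, of a random sign with mean `x`. -/
def signMGF (x a : ℝ) : ℝ := Real.cosh a + x * Real.sinh a

lemma signMGF_eq (x a : ℝ) :
    signMGF x a = ((1 + x) * Real.exp a + (1 - x) * Real.exp (-a)) / 2 := by
  rw [signMGF, Real.cosh_eq, Real.sinh_eq]
  ring

lemma signMGF_neg_neg (x a : ℝ) : signMGF (-x) (-a) = signMGF x a := by
  simp [signMGF]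

lemma signMGF_pos {x : ℝ} (hx : |x| ≤ 1) (a : ℝ) : 0 < signMGF x a :=
  (Real.exp_pos _).trans_le (Real.exp_mul_le_cosh_add_mul_sinh hx a)

/-- A form of Hoeffding's lemma: by Jensen's inequality, centring a random sign costs at most as
much as subtracting an independent copy of it. -/
lemma signMGF_le {x : ℝ} (hx : |x| ≤ 1) (a : ℝ) :
    signMGF x a ≤ Real.exp (a * x + a ^ 2) := by
  have h1 : Real.exp (-(a * x)) ≤ signMGF (-x) a := by
    have := Real.exp_mul_le_cosh_add_mul_sinh (t := -x) (by simpa using hx) a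
    rwa [neg_mul, mul_comm x a] at this
  have h2 : signMGF x a * signMGF (-x) a ≤ Real.exp (a ^ 2) := by
    have h3 : signMGF x a * signMGF (-x) a ≤ Real.cosh a ^ 2 := by
      simp only [signMGF]
      nlinarith [sq_nonneg (x * Real.sinh a)]
    refine h3.trans ?_
    calc Real.cosh a ^ 2 ≤ Real.exp (a ^ 2 / 2) ^ 2 := by
          have := (Real.cosh_pos a).le
          gcongr
          exact Real.cosh_le_exp_half_sq a
      _ = Real.exp (a ^ 2) := by rw [← Real.exp_nat_mul]; congr 1; push_cast; ring
  rw [add_comm, Real.exp_add, ← neg_neg (a * x), Real.exp_neg (-(a * x)), ← div_eq_mul_inv,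
    le_div_iff₀ (Real.exp_pos _)]
  exact (mul_le_mul_of_nonneg_left h1 (signMGF_pos hx a).le).trans h2

/-- The mean of a random sign with mean `x` under the exponential tilt by `a`. -/
def tiltedMean (x a : ℝ) : ℝ := (Real.sinh a + x * Real.cosh a) / signMGF x a

lemma abs_tiltedMean_le {x : ℝ} (hx : |x| ≤ 1) (a : ℝ) : |tiltedMean x a| ≤ 1 := by
  have hf := signMGF_pos hx a
  obtain ⟨h1, h2⟩ := abs_le.1 hx
  rw [tiltedMean, abs_div, abs_of_pos hf, div_le_one hf, signMGF, abs_le, Real.cosh_eq,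
    Real.sinh_eq]
  constructor <;> nlinarith [Real.exp_pos a, Real.exp_pos (-a)]

lemma signMGF_add {x : ℝ} (hx : |x| ≤ 1) (a b : ℝ) :
    signMGF x (a + b) = signMGF x a * signMGF (tiltedMean x a) b := by
  have hf := (signMGF_pos hx a).ne'
  rw [signMGF.eq_1 (tiltedMean x a), tiltedMean, mul_add, div_mul_eq_mul_div,
    mul_div_cancel₀ _ hf, signMGF, signMGF, Real.cosh_add, Real.sinh_add]
  ring

lemma tiltedMean_sub {x : ℝ} (hx : |x| ≤ 1) (a : ℝ) :
    tiltedMean x a - x = (1 - x ^ 2) * Real.sinh a / signMGF x a := by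
  have hf := (signMGF_pos hx a).ne'
  rw [tiltedMean, div_sub' hf]
  congr 1
  rw [signMGF]
  ring

lemma tiltedMean_neg_neg (x a : ℝ) : tiltedMean (-x) (-a) = -tiltedMean x a := by
  rw [tiltedMean, tiltedMean, signMGF_neg_neg, Real.sinh_neg, Real.cosh_neg]
  ring

/-- Tilting by `a` shifts the mean in the direction of `a`, by at most `4 * |a|`. -/
lemma exists_tiltedMean_sub_eq {x : ℝ} (hx : |x| ≤ 1) (a : ℝ) :
    ∃ μ, 0 ≤ μ ∧ μ ≤ 4 ∧ tiltedMean x a - x = μ * a := by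
  wlog ha : 0 ≤ a generalizing x a
  · obtain ⟨μ, h0, h4, h⟩ := this (x := -x) (by simpa using hx) (-a) (by linarith)
    refine ⟨μ, h0, h4, ?_⟩
    rw [tiltedMean_neg_neg] at h
    linarith
  obtain ⟨h1, h2⟩ := abs_le.1 hx
  have hf := signMGF_pos hx a
  rcases ha.eq_or_lt with rfl | ha
  · exact ⟨0, le_rfl, by norm_num, by rw [tiltedMean_sub hx]; simp⟩
  have hsinh : 0 ≤ Real.sinh a := (Real.sinh_pos_iff.2 ha).le
  have hx2 : 0 ≤ 1 - x ^ 2 := by nlinarith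
  refine ⟨(1 - x ^ 2) * Real.sinh a / signMGF x a / a, by positivity, ?_, ?_⟩
  · rw [div_le_iff₀ ha, div_le_iff₀ hf]
    have h3 : (1 + x) * Real.exp a ≤ 2 * signMGF x a := by
      rw [signMGF_eq]
      nlinarith [Real.exp_pos (-a)]
    have h4 : Real.sinh a * 2 ≤ 2 * a * Real.exp a := by
      have h5 := Real.add_one_le_exp (-(2 * a))
      have h6 : Real.exp (-a) = Real.exp (-(2 * a)) * Real.exp a := by
        rw [← Real.exp_add]; congr 1; ring
      rw [Real.sinh_eq, h6]
      nlinarith [Real.exp_pos a]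
    calc (1 - x ^ 2) * Real.sinh a ≤ (1 - x ^ 2) * (a * Real.exp a) := by gcongr; linarith
      _ = (1 - x) * a * ((1 + x) * Real.exp a) := by ring
      _ ≤ 2 * a * (2 * signMGF x a) := by
          have : 0 ≤ (1 + x) * Real.exp a := mul_nonneg (by linarith) (Real.exp_pos a).le
          gcongr
          linarith
      _ = 4 * a * signMGF x a := by ring
  · rw [tiltedMean_sub hx, div_mul_cancel₀ _ ha.ne']

/-! ### The potential of a pivot -/

/-- The exponential moment of `a * (X - x)` for a random sign `X` with mean `x`, discounted by the
factor `exp (-20 * a ^ 2)`. -/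
def pivotPotential (x a : ℝ) : ℝ := signMGF x a * Real.exp (-(a * x) - 20 * a ^ 2)

lemma pivotPotential_nonneg {x : ℝ} (hx : |x| ≤ 1) (a : ℝ) : 0 ≤ pivotPotential x a :=
  mul_nonneg (signMGF_pos hx a).le (Real.exp_pos _).le

lemma pivotPotential_le_one {x : ℝ} (hx : |x| ≤ 1) (a : ℝ) : pivotPotential x a ≤ 1 := by
  calc pivotPotential x a ≤ Real.exp (a * x + a ^ 2) * Real.exp (-(a * x) - 20 * a ^ 2) := by
        rw [pivotPotential]; gcongr; exact signMGF_le hx a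
    _ = Real.exp (-(19 * a ^ 2)) := by rw [← Real.exp_add]; congr 1; ring
    _ ≤ 1 := Real.exp_le_one_iff.2 (by nlinarith [sq_nonneg a])

lemma pivotPotential_of_abs_eq_one {x : ℝ} (hx : |x| = 1) (a : ℝ) :
    pivotPotential x a = Real.exp (-(20 * a ^ 2)) := by
  have h : signMGF x a = Real.exp (a * x) := by
    rw [signMGF_eq]
    rcases eq_or_eq_neg_of_abs_eq hx with rfl | rfl <;> norm_num
  rw [pivotPotential, h, ← Real.exp_add]
  congr 1
  ring

/-- Changing the slope from `a` to `a + b` is paid for by any `Δ ≥ 0` with `-4 * a * b ≤ Δ`.  The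
discount pays when `a` and `b` have the same sign, and `Δ` pays when they have opposite signs. -/
lemma pivotPotential_add_le {x : ℝ} (hx : |x| ≤ 1) {a b Δ : ℝ} (hΔ : 0 ≤ Δ)
    (h : -(4 * (a * b)) ≤ Δ) :
    pivotPotential x (a + b) ≤ pivotPotential x a * Real.exp (20 * Δ) := by
  obtain ⟨μ, h0, h4, hμ⟩ := exists_tiltedMean_sub_eq hx a
  have h1 : signMGF x (a + b) ≤ signMGF x a * Real.exp (b * tiltedMean x a + b ^ 2) := by
    rw [signMGF_add hx]
    exact mul_le_mul_of_nonneg_left (signMGF_le (abs_tiltedMean_le hx a) b) (signMGF_pos hx a).le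
  calc pivotPotential x (a + b)
      ≤ signMGF x a * Real.exp (b * tiltedMean x a + b ^ 2) *
          Real.exp (-((a + b) * x) - 20 * (a + b) ^ 2) := by rw [pivotPotential]; gcongr
    _ = signMGF x a * Real.exp (b * tiltedMean x a + b ^ 2 +
          (-((a + b) * x) - 20 * (a + b) ^ 2)) := by rw [mul_assoc, ← Real.exp_add]
    _ ≤ signMGF x a * Real.exp ((-(a * x) - 20 * a ^ 2) + 20 * Δ) := by
        refine mul_le_mul_of_nonneg_left (Real.exp_le_exp.2 ?_) (signMGF_pos hx a).le
        rw [show tiltedMean x a = x + μ * a by linarith]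
        have hb := sq_nonneg b
        rcases le_total 0 (a * b) with hab | hab
        · nlinarith
        · nlinarith
    _ = pivotPotential x a * Real.exp (20 * Δ) := by rw [pivotPotential, mul_assoc, Real.exp_add]

/-- For a fixed slope `a`, the process `exp (a * x) * pivotPotential x a` is a martingale whenever
`x` is, since `signMGF x a` is affine in `x`. -/
lemma pivotPotential_martingale (x a q δ ε : ℝ) (h : q * δ + (1 - q) * ε = 0) :
    q * (Real.exp (a * δ) * pivotPotential (x + δ) a) +
      (1 - q) * (Real.exp (a * ε) * pivotPotential (x + ε) a) = pivotPotential x a := by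
  have key : ∀ d, Real.exp (a * d) * pivotPotential (x + d) a =
      (signMGF x a + d * Real.sinh a) * Real.exp (-(a * x) - 20 * a ^ 2) := by
    intro d
    rw [pivotPotential, mul_left_comm, ← Real.exp_add, signMGF, signMGF]
    ring_nf
  rw [key, key, pivotPotential]
  linear_combination Real.sinh a * Real.exp (-(a * x) - 20 * a ^ 2) * h

/-! ### Projections and the residual of the pivot -/

section Projection

variable {E : Type*} [NormedAddCommGroup E] [InnerProductSpace ℝ E] [FiniteDimensional ℝ E]

/-- The squared norm of the orthogonal projection of `θ` onto `U`. -/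
def energy (U : Submodule ℝ E) (θ : E) : ℝ := ‖U.starProjection θ‖ ^ 2

lemma energy_nonneg (U : Submodule ℝ E) (θ : E) : 0 ≤ energy U θ := sq_nonneg _

lemma energy_le (U : Submodule ℝ E) (θ : E) : energy U θ ≤ ‖θ‖ ^ 2 := by
  rw [energy, Submodule.norm_sq_eq_add_norm_sq_starProjection θ U]
  nlinarith [sq_nonneg ‖Uᗮ.starProjection θ‖]

lemma inner_sq_le_energy_sub {U U' : Submodule ℝ E} (h : U' ≤ U) (θ : E) {z : E} (hz : z ∈ U)
    (hz' : z ∈ U'ᗮ) : inner ℝ θ z ^ 2 ≤ ‖z‖ ^ 2 * (energy U θ - energy U' θ) := by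
  set p := U.starProjection θ
  have hp' : U'.starProjection p = U'.starProjection θ :=
    congrArg (· θ) (Submodule.starProjection_comp_starProjection_of_le h)
  have h1 : inner ℝ θ z = inner ℝ (p - U'.starProjection θ) z := by
    have e1 : inner ℝ (θ - p) z = 0 := U.starProjection_inner_eq_zero θ z hz
    have e2 : inner ℝ (U'.starProjection θ) z = 0 :=
      (Submodule.mem_orthogonal _ _).1 hz' _ (U'.starProjection_apply_mem θ)
    rw [inner_sub_left] at e1 ⊢
    linarith
  have h2 : energy U θ - energy U' θ = ‖p - U'.starProjection θ‖ ^ 2 := by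
    have e1 : inner ℝ (p - U'.starProjection p) (U'.starProjection p) = 0 :=
      U'.starProjection_inner_eq_zero p _ (U'.starProjection_apply_mem p)
    rw [hp'] at e1
    have e2 := norm_add_sq_real (p - U'.starProjection θ) (U'.starProjection θ)
    rw [sub_add_cancel, e1] at e2
    rw [energy, energy]
    linarith
  rw [h1, h2, ← mul_pow, mul_comm, ← sq_abs]
  gcongr
  exact abs_real_inner_le_norm _ _

lemma energy_mono {U U' : Submodule ℝ E} (h : U' ≤ U) (θ : E) : energy U' θ ≤ energy U θ := by
  have hp' : U'.starProjection (U.starProjection θ) = U'.starProjection θ :=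
    congrArg (· θ) (Submodule.starProjection_comp_starProjection_of_le h)
  rw [energy, ← hp']
  exact energy_le U' (U.starProjection θ)

/-- Shrinking the span of the non-pivots from `V` to `V'` turns the residual `w` of the pivot `c`
into `w'`; the two subspaces are `U` and `U'` once the pivot is added.  The energy that is lost
bounds the product of the old slope `⟪θ, w⟫` and its change `⟪θ, w' - w⟫` from below, because `U`
contains `‖w' - w‖² • w - ‖w‖² • (w' - w)`, which is orthogonal to `U'`. -/
lemma neg_four_mul_inner_mul_inner_le {V V' U U' : Submodule ℝ E} {c w w' : E} (θ : E)
    (hV : V' ≤ V) (hU : U' ≤ U) (hVU : V ≤ U) (hcU : c ∈ U) (hU' : U' ≤ V' ⊔ ℝ ∙ c)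
    (hc : ‖c‖ ≤ 1) (hw : c - w ∈ V) (hw' : c - w' ∈ V') (ho : w ∈ Vᗮ) (ho' : w' ∈ V'ᗮ) :
    -(4 * (inner ℝ θ w * inner ℝ θ (w' - w))) ≤ energy U θ - energy U' θ := by
  set r := w' - w with hr
  have hrV : r ∈ V := by
    have : r = (c - w) - (c - w') := by rw [hr]; abel
    exact this ▸ V.sub_mem hw (hV hw')
  have hwr : inner ℝ w r = 0 := (Submodule.mem_orthogonal' _ _).1 ho _ hrV
  have hw'eq : w' = w + r := by rw [hr]; abel
  have hnorm : ‖w‖ ^ 2 + ‖r‖ ^ 2 ≤ 1 := by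
    have e1 : ‖w'‖ ^ 2 = ‖w‖ ^ 2 + ‖r‖ ^ 2 := by rw [hw'eq, norm_add_sq_real, hwr]; ring
    have e2 : inner ℝ w' (c - w') = 0 := (Submodule.mem_orthogonal' _ _).1 ho' _ hw'
    have e3 := norm_add_sq_real w' (c - w')
    rw [add_sub_cancel, e2] at e3
    nlinarith [norm_nonneg c, sq_nonneg ‖c - w'‖]
  set s := ‖w‖ ^ 2
  set ρ := ‖r‖ ^ 2
  have hs : 0 ≤ s := sq_nonneg _
  have hρ : 0 ≤ ρ := sq_nonneg _
  have hΔ : 0 ≤ energy U θ - energy U' θ := sub_nonneg.2 (energy_mono hU θ)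
  set z := ρ • w - s • r with hz
  have hwU : w ∈ U := by
    have : w = c - (c - w) := by abel
    exact this ▸ U.sub_mem hcU (hVU hw)
  have hzU : z ∈ U := U.sub_mem (U.smul_mem _ hwU) (U.smul_mem _ (hVU hrV))
  have hww : inner ℝ w w = s := real_inner_self_eq_norm_sq w
  have hrr : inner ℝ r r = ρ := real_inner_self_eq_norm_sq r
  have hwo : ∀ y ∈ V', inner ℝ w y = 0 := fun y hy => (Submodule.mem_orthogonal' _ _).1 ho _ (hV hy)
  have hro : ∀ y ∈ V', inner ℝ r y = 0 := fun y hy => by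
    rw [hr, inner_sub_left, hwo y hy, (Submodule.mem_orthogonal' _ _).1 ho' _ hy, sub_zero]
  have hzV : ∀ y ∈ V', inner ℝ z y = 0 := fun y hy => by
    rw [hz, inner_sub_left, real_inner_smul_left, real_inner_smul_left, hwo y hy, hro y hy]
    ring
  have hzc : inner ℝ z c = 0 := by
    have e1 : inner ℝ z w' = 0 := by
      rw [hz, hw'eq, inner_sub_left, real_inner_smul_left, real_inner_smul_left, inner_add_right,
        inner_add_right, hww, hrr, real_inner_comm w r, hwr]
      ring
    have e2 := hzV _ hw'
    rw [inner_sub_right, e1] at e2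
    linarith
  have hzU' : z ∈ U'ᗮ := by
    rw [Submodule.mem_orthogonal']
    intro y hy
    obtain ⟨y₁, hy₁, y₂, hy₂, rfl⟩ := Submodule.mem_sup.1 (hU' hy)
    obtain ⟨t, rfl⟩ := Submodule.mem_span_singleton.1 hy₂
    rw [inner_add_right, hzV _ hy₁, real_inner_smul_right, hzc]
    ring
  have h := inner_sq_le_energy_sub hU θ hzU hzU'
  have hzn : ‖z‖ ^ 2 = ρ * s * (s + ρ) := by
    rw [← real_inner_self_eq_norm_sq, hz]
    simp only [inner_sub_left, inner_sub_right, real_inner_smul_left, real_inner_smul_right, hww,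
      hrr, hwr, real_inner_comm w r]
    ring
  rw [hzn, hz, inner_sub_right, real_inner_smul_right, real_inner_smul_right] at h
  set a := inner ℝ θ w with ha
  set b := inner ℝ θ r with hb
  rcases hs.eq_or_lt with h0 | hs'
  · have : w = 0 := by simpa [s] using h0.symm
    rw [ha, this]; simpa using hΔ
  rcases hρ.eq_or_lt with h0 | hρ'
  · have : r = 0 := by simpa [ρ] using h0.symm
    rw [hb, this]; simpa using hΔ
  have h1 : ρ * s * (-(4 * (a * b))) ≤ ρ * s * (energy U θ - energy U' θ) := by
    have h2 : ρ * s * (s + ρ) * (energy U θ - energy U' θ) ≤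
        ρ * s * (energy U θ - energy U' θ) := by
      have : 0 ≤ ρ * s * (energy U θ - energy U' θ) := by positivity
      nlinarith
    nlinarith [sq_nonneg (ρ * a + s * b)]
  exact le_of_mul_le_mul_left h1 (by positivity)

end Projection
/-! ### The potential of a fractional coloring -/

section Potential

variable {E : Type*} [NormedAddCommGroup E] [InnerProductSpace ℝ E] {n : ℕ}

/-- The coordinates of a fractional coloring that are not yet frozen at `-1` or `1`. -/
def alive (x : Fin n → ℝ) : Finset (Fin n) := {i | |x i| < 1}

lemma mem_alive {x : Fin n → ℝ} {i : Fin n} : i ∈ alive x ↔ |x i| < 1 := by simp [alive]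

/-- The span of the vectors in `A`. -/
def spanOf (v : Fin n → E) (A : Finset (Fin n)) : Submodule ℝ E := Submodule.span ℝ (v '' A)

lemma spanOf_mono (v : Fin n → E) {A B : Finset (Fin n)} (h : A ⊆ B) : spanOf v A ≤ spanOf v B :=
  Submodule.span_mono (Set.image_mono (Finset.coe_subset.2 h))

lemma mem_spanOf (v : Fin n → E) {A : Finset (Fin n)} {i : Fin n} (h : i ∈ A) :
    v i ∈ spanOf v A := Submodule.subset_span ⟨i, h, rfl⟩

lemma spanOf_le_sup (v : Fin n → E) (A : Finset (Fin n)) (p : Fin n) :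
    spanOf v A ≤ spanOf v (A.erase p) ⊔ ℝ ∙ v p := by
  refine Submodule.span_le.2 ?_
  rintro _ ⟨i, hi, rfl⟩
  by_cases hip : i = p
  · subst hip
    exact Submodule.mem_sup_right (Submodule.mem_span_singleton_self _)
  · exact Submodule.mem_sup_left (mem_spanOf v (Finset.mem_erase.2 ⟨hip, hi⟩))

variable [FiniteDimensional ℝ E]

/-- The component of `v p` that is orthogonal to the other vectors in `A`. -/
def residual (v : Fin n → E) (A : Finset (Fin n)) (p : Fin n) : E :=
  v p - (spanOf v (A.erase p)).starProjection (v p)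

lemma residual_mem_orthogonal (v : Fin n → E) (A : Finset (Fin n)) (p : Fin n) :
    residual v A p ∈ (spanOf v (A.erase p))ᗮ :=
  Submodule.sub_starProjection_mem_orthogonal _

lemma sub_residual_mem (v : Fin n → E) (A : Finset (Fin n)) (p : Fin n) :
    v p - residual v A p ∈ spanOf v (A.erase p) := by
  rw [residual, sub_sub_cancel]
  exact Submodule.starProjection_apply_mem _ _

lemma norm_residual_le (v : Fin n → E) (A : Finset (Fin n)) (p : Fin n) :
    ‖residual v A p‖ ≤ ‖v p‖ := by
  have h := norm_add_sq_real (residual v A p) (v p - residual v A p)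
  rw [(Submodule.mem_orthogonal' _ _).1 (residual_mem_orthogonal v A p) _ (sub_residual_mem v A p),
    add_sub_cancel] at h
  exact le_of_sq_le_sq (by nlinarith [sq_nonneg ‖v p - residual v A p‖]) (norm_nonneg _)

lemma residual_mem_spanOf (v : Fin n → E) {A : Finset (Fin n)} {p : Fin n} (hp : p ∈ A) :
    residual v A p ∈ spanOf v A := by
  have := (spanOf v A).sub_mem (mem_spanOf v hp)
    (spanOf_mono v (Finset.erase_subset p A) (sub_residual_mem v A p))
  rwa [sub_sub_cancel] at this

/-- The pivot is the last coordinate that is alive. -/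
def IsPivot (x : Fin n → ℝ) (p : Fin n) : Prop := IsGreatest (alive x : Set (Fin n)) p

/-- An upper bound for the exponential moment of `⟪θ, ·⟫` at the displacement of the walk from `x`
until all coordinates are frozen: each direction that is still available contributes its energy,
and the pivot contributes the moment of its own future displacement. -/
def potential (v : Fin n → E) (θ : E) (x : Fin n → ℝ) : ℝ :=
  Real.exp (20 * energy (spanOf v (alive x)) θ) *
    if h : (alive x).Nonempty then
      pivotPotential (x ((alive x).max' h)) (inner ℝ θ (residual v (alive x) ((alive x).max' h)))
    else 1

lemma potential_of_isPivot (v : Fin n → E) (θ : E) {x : Fin n → ℝ} {p : Fin n}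
    (hp : IsPivot x p) : potential v θ x = Real.exp (20 * energy (spanOf v (alive x)) θ) *
      pivotPotential (x p) (inner ℝ θ (residual v (alive x) p)) := by
  have h : (alive x).Nonempty := ⟨p, hp.1⟩
  have e : (alive x).max' h = p := ((alive x).isGreatest_max' h).unique hp
  rw [potential, dif_pos h, e]

lemma potential_le (v : Fin n → E) (θ : E) {x : Fin n → ℝ} (hx : ∀ i, |x i| ≤ 1) :
    potential v θ x ≤ Real.exp (20 * energy (spanOf v (alive x)) θ) := by
  rw [potential]
  refine mul_le_of_le_one_right (Real.exp_pos _).le ?_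
  split_ifs
  · exact pivotPotential_le_one (hx _) _
  · exact le_rfl

lemma potential_nonneg (v : Fin n → E) (θ : E) {x : Fin n → ℝ} (hx : ∀ i, |x i| ≤ 1) :
    0 ≤ potential v θ x := by
  refine mul_nonneg (Real.exp_pos _).le ?_
  split_ifs
  · exact pivotPotential_nonneg (hx _) _
  · exact zero_le_one

lemma one_le_potential_of_alive_eq_empty (v : Fin n → E) (θ : E) {x : Fin n → ℝ}
    (hx : alive x = ∅) : 1 ≤ potential v θ x := by
  rw [potential, dif_neg (by simp [hx]), mul_one]
  exact Real.one_le_exp (mul_nonneg (by norm_num) (energy_nonneg _ _))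

/-- When further coordinates freeze, the potential is at most what it was just before the freezing.
If the pivot survives, the lost energy pays for the change of its residual; if it does not, the
lost energy pays for the discount in `pivotPotential`. -/
lemma potential_le_of_alive_subset {v : Fin n → E} (hv : ∀ i, ‖v i‖ ≤ 1) (θ : E)
    {x y : Fin n → ℝ} (hy : ∀ i, |y i| ≤ 1) (hxy : alive y ⊆ alive x) {p : Fin n}
    (hp : IsPivot x p) :
    potential v θ y ≤ Real.exp (20 * energy (spanOf v (alive x)) θ) *
      pivotPotential (y p) (inner ℝ θ (residual v (alive x) p)) := by
  set w := residual v (alive x) p with hw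
  by_cases hpy : p ∈ alive y
  · rw [potential_of_isPivot v θ ⟨hpy, fun i hi => hp.2 (hxy hi)⟩]
    set w' := residual v (alive y) p with hw'
    have h := neg_four_mul_inner_mul_inner_le (c := v p) (w := w) (w' := w') θ
      (spanOf_mono v (Finset.erase_subset_erase p hxy)) (spanOf_mono v hxy)
      (spanOf_mono v (Finset.erase_subset p _)) (mem_spanOf v hp.1) (spanOf_le_sup v _ p) (hv p)
      (sub_residual_mem v _ p) (sub_residual_mem v _ p) (residual_mem_orthogonal v _ p)
      (residual_mem_orthogonal v _ p)
    have h2 := pivotPotential_add_le (hy p)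
      (sub_nonneg.2 (energy_mono (spanOf_mono v hxy) θ)) h
    rw [← inner_add_right, add_sub_cancel] at h2
    calc _ ≤ Real.exp (20 * energy (spanOf v (alive y)) θ) * (pivotPotential (y p) (inner ℝ θ w) *
            Real.exp (20 * (energy (spanOf v (alive x)) θ - energy (spanOf v (alive y)) θ))) := by
          gcongr
      _ = _ := by
          rw [mul_left_comm, ← Real.exp_add, mul_comm]
          congr 2
          ring
  · have hyp : |y p| = 1 := le_antisymm (hy p) (not_lt.1 fun h => hpy (mem_alive.2 h))
    rw [pivotPotential_of_abs_eq_one hyp, ← Real.exp_add]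
    refine (potential_le v θ hy).trans (Real.exp_le_exp.2 ?_)
    have hyp' : alive y ⊆ (alive x).erase p := fun i hi =>
      Finset.mem_erase.2 ⟨fun h => hpy (h ▸ hi), hxy hi⟩
    have h := inner_sq_le_energy_sub (spanOf_mono v hxy) θ (residual_mem_spanOf v hp.1)
      (Submodule.orthogonal_le (spanOf_mono v hyp') (residual_mem_orthogonal v (alive x) p))
    have hn : ‖w‖ ^ 2 ≤ 1 := pow_le_one₀ (norm_nonneg _) ((norm_residual_le v _ p).trans (hv p))
    have hΔ := sub_nonneg.2 (energy_mono (spanOf_mono v hxy) θ)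
    nlinarith

/-! ### One step of the walk -/

/-- The direction of a step of the walk: the pivot moves at unit speed, frozen coordinates do not
move, and the vector sum moves orthogonally to all vectors that are alive, the pivot excepted. -/
structure IsStepDirection (v : Fin n → E) (x : Fin n → ℝ) (p : Fin n) (u : Fin n → ℝ) : Prop where
  pivot : u p = 1
  frozen : ∀ i, i ∉ alive x → u i = 0
  orthogonal : ∀ j ∈ alive x, j ≠ p → inner ℝ (∑ i, u i • v i) (v j) = 0

lemma IsStepDirection.sum_eq_residual {v : Fin n → E} {x : Fin n → ℝ} {p : Fin n}
    {u : Fin n → ℝ} (hu : IsStepDirection v x p u) :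
    ∑ i, u i • v i = residual v (alive x) p := by
  have h1 : v p - ∑ i, u i • v i ∈ spanOf v ((alive x).erase p) := by
    rw [← Finset.add_sum_erase _ _ (Finset.mem_univ p), hu.pivot, one_smul, sub_add_cancel_left]
    refine Submodule.neg_mem _ (Submodule.sum_mem _ fun i hi => ?_)
    by_cases hia : i ∈ alive x
    · exact Submodule.smul_mem _ _
        (mem_spanOf v (Finset.mem_erase.2 ⟨Finset.ne_of_mem_erase hi, hia⟩))
    · rw [hu.frozen i hia, zero_smul]
      exact Submodule.zero_mem _
  have h2 : ∑ i, u i • v i ∈ (spanOf v ((alive x).erase p))ᗮ := by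
    rw [spanOf, Submodule.mem_orthogonal']
    intro y hy
    induction hy using Submodule.span_induction with
    | mem y hy =>
      obtain ⟨j, hj, rfl⟩ := hy
      obtain ⟨hjp, hja⟩ := Finset.mem_erase.1 hj
      exact hu.orthogonal j hja hjp
    | zero => exact inner_zero_right _
    | add y z _ _ hy hz => rw [inner_add_right, hy, hz, add_zero]
    | smul t y _ hy => rw [real_inner_smul_right, hy, mul_zero]
  rw [residual, Submodule.eq_starProjection_of_mem_orthogonal h1 (by rwa [sub_sub_cancel]),
    sub_sub_cancel]

/-- The potential pays for a mean-zero step of the walk. -/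
lemma potential_step {v : Fin n → E} (hv : ∀ i, ‖v i‖ ≤ 1) (θ : E) {x : Fin n → ℝ} {p : Fin n}
    (hp : IsPivot x p) {u : Fin n → ℝ} (hu : IsStepDirection v x p u) {q δ ε : ℝ} (hq0 : 0 ≤ q)
    (hq1 : q ≤ 1) (hmean : q * δ + (1 - q) * ε = 0) (hδ : ∀ i, |x i + δ * u i| ≤ 1)
    (hε : ∀ i, |x i + ε * u i| ≤ 1) :
    q * (Real.exp (inner ℝ θ (∑ i, (δ * u i) • v i)) * potential v θ fun i => x i + δ * u i) +
      (1 - q) * (Real.exp (inner ℝ θ (∑ i, (ε * u i) • v i)) *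
        potential v θ fun i => x i + ε * u i) ≤ potential v θ x := by
  set a := inner ℝ θ (residual v (alive x) p) with ha
  set e := Real.exp (20 * energy (spanOf v (alive x)) θ) with he
  have key : ∀ d : ℝ, (∀ i, |x i + d * u i| ≤ 1) →
      Real.exp (inner ℝ θ (∑ i, (d * u i) • v i)) * potential v θ (fun i => x i + d * u i) ≤
        e * (Real.exp (a * d) * pivotPotential (x p + d) a) := by
    intro d hd
    have h1 : inner ℝ θ (∑ i, (d * u i) • v i) = a * d := by
      simp only [mul_smul]
      rw [← Finset.smul_sum, hu.sum_eq_residual, real_inner_smul_right, mul_comm]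
    have h2 : alive (fun i => x i + d * u i) ⊆ alive x := by
      intro i hi
      by_contra hia
      refine hia (mem_alive.2 ?_)
      simpa [hu.frozen i hia] using mem_alive.1 hi
    have h3 := potential_le_of_alive_subset hv θ hd h2 hp
    rw [hu.pivot, mul_one] at h3
    rw [h1, mul_left_comm]
    exact mul_le_mul_of_nonneg_left h3 (Real.exp_pos _).le
  rw [potential_of_isPivot v θ hp, ← pivotPotential_martingale (x p) a q δ ε hmean]
  have h1 := mul_le_mul_of_nonneg_left (key δ hδ) hq0
  have h2 := mul_le_mul_of_nonneg_left (key ε hε) (sub_nonneg.2 hq1)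
  linarith

end Potential
/-! ### Gram-Schmidt orthogonalization of the rows of an array -/

section Orthogonalization

open Finset

/-- The inner product of the first `m` entries of two rows. -/
def dot (m : ℕ) (y z : ℕ → ℝ) : ℝ := ∑ l ∈ range m, y l * z l

lemma dot_comm (m : ℕ) (y z : ℕ → ℝ) : dot m y z = dot m z y := by
  simp only [dot, mul_comm]

lemma dot_self_eq_zero {m : ℕ} {y : ℕ → ℝ} (h : dot m y y = 0) (z : ℕ → ℝ) : dot m z y = 0 := by
  rw [dot, sum_eq_zero_iff_of_nonneg fun l _ => mul_self_nonneg _] at h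
  exact sum_eq_zero fun l hl => by rw [mul_self_eq_zero.1 (h l hl), mul_zero]

/-- Subtract from the first `M` entries of row `j` the multiple of row `k` that makes row `j`
orthogonal to row `k`, with respect to the first `m` entries.  If row `k` vanishes there, the
multiple is `0` by the convention `x / 0 = 0`. -/
def reduceRow (m M : ℕ) (R : ℕ → ℕ → ℝ) (j k : ℕ) : ℕ → ℕ → ℝ := fun i l =>
  if i = j ∧ l < M then R j l - dot m (R j) (R k) / dot m (R k) (R k) * R k l else R i l

/-- Reduce row `j` successively by the rows `0, …, k - 1`. -/
def reduceRows (m M : ℕ) (R : ℕ → ℕ → ℝ) (j : ℕ) : ℕ → ℕ → ℕ → ℝ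
  | 0 => R
  | k + 1 => reduceRow m M (reduceRows m M R j k) j k

/-- Reduce each of the rows `0, …, j - 1` by the rows above it. -/
def orthogonalize (m M : ℕ) (R : ℕ → ℕ → ℝ) : ℕ → ℕ → ℕ → ℝ
  | 0 => R
  | j + 1 => reduceRows m M (orthogonalize m M R j) j j

variable {m M : ℕ} {R : ℕ → ℕ → ℝ}

lemma reduceRow_of_ne {i j : ℕ} (h : i ≠ j) (k : ℕ) : reduceRow m M R j k i = R i := by
  funext l
  simp [reduceRow, h]

lemma reduceRows_of_ne {i j : ℕ} (h : i ≠ j) (k : ℕ) : reduceRows m M R j k i = R i := by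
  induction k with
  | zero => rfl
  | succ k ih => rw [reduceRows, reduceRow_of_ne h, ih]

lemma orthogonalize_of_le {i j : ℕ} (h : j ≤ i) : orthogonalize m M R j i = R i := by
  induction j with
  | zero => rfl
  | succ j ih => rw [orthogonalize, reduceRows_of_ne (by lia), ih (by lia)]

lemma dot_reduceRow (hm : m ≤ M) (z : ℕ → ℝ) (j k : ℕ) :
    dot m z (reduceRow m M R j k j) =
      dot m z (R j) - dot m (R j) (R k) / dot m (R k) (R k) * dot m z (R k) := by
  simp only [dot]
  rw [mul_sum, ← sum_sub_distrib]
  refine sum_congr rfl fun l hl => ?_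
  rw [reduceRow, if_pos ⟨rfl, (mem_range.1 hl).trans_le hm⟩]
  simp only [dot]
  ring

lemma dot_reduceRow_self (hm : m ≤ M) (j k : ℕ) :
    dot m (R k) (reduceRow m M R j k j) = 0 := by
  rw [dot_reduceRow hm]
  by_cases h : dot m (R k) (R k) = 0
  · rw [dot_comm m (R k) (R j), dot_self_eq_zero h, h]
    simp
  · rw [div_mul_cancel₀ _ h, dot_comm m (R k) (R j), sub_self]

/-- A row with index at least `j` that is orthogonal to the first `k` rows has the same inner
product with row `j` before and after its reduction by these rows. -/
lemma dot_reduceRows_of_orthogonal (hm : m ≤ M) {j k : ℕ} (hk : k ≤ j) (z : ℕ → ℝ)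
    (hz : ∀ k' < k, dot m z (R k') = 0) :
    dot m z (reduceRows m M R j k j) = dot m z (R j) := by
  induction k with
  | zero => rfl
  | succ k ih =>
    rw [reduceRows, dot_reduceRow hm, ih (by lia) fun k' h => hz k' (h.trans k.lt_succ_self),
      reduceRows_of_ne (i := k) (by lia), hz k k.lt_succ_self]
    ring

lemma dot_reduceRows_eq_zero (hm : m ≤ M) {j k : ℕ} (hk : k ≤ j)
    (hR : ∀ k₁ < j, ∀ k₂ < k₁, dot m (R k₁) (R k₂) = 0) :
    ∀ k' < k, dot m (R k') (reduceRows m M R j k j) = 0 := by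
  induction k with
  | zero => intro k' h; lia
  | succ k ih =>
    intro k' h
    rcases Nat.lt_succ_iff_lt_or_eq.1 h with h | rfl
    · rw [reduceRows, dot_reduceRow hm, ih (by lia) k' h, reduceRows_of_ne (i := k) (by lia),
        dot_comm m (R k'), hR k (by lia) k' h]
      ring
    · rw [reduceRows]
      nth_rewrite 1 [← reduceRows_of_ne (m := m) (M := M) (R := R) (by lia : k' ≠ j) k']
      exact dot_reduceRow_self hm j k'

lemma orthogonalize_orthogonal (hm : m ≤ M) (J : ℕ) :
    ∀ j < J, ∀ k < j, dot m (orthogonalize m M R J j) (orthogonalize m M R J k) = 0 := by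
  induction J with
  | zero => intro j h; lia
  | succ J ih =>
    intro j hj k hk
    rw [orthogonalize, reduceRows_of_ne (i := k) (by lia)]
    rcases Nat.lt_succ_iff_lt_or_eq.1 hj with h | rfl
    · rw [reduceRows_of_ne (by lia), ih j h k hk]
    · rw [dot_comm]
      exact dot_reduceRows_eq_zero hm le_rfl ih k hk

/-- What is orthogonal to the new rows `0, …, j` is orthogonal to the old row `j`. -/
lemma dot_eq_zero_of_orthogonalize (hm : m ≤ M) (J : ℕ) : ∀ j < J, ∀ z : ℕ → ℝ,
    (∀ k ≤ j, dot m z (orthogonalize m M R J k) = 0) → dot m z (R j) = 0 := by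
  induction J with
  | zero => intro j h; lia
  | succ J ih =>
    intro j hj z hz
    rcases Nat.lt_succ_iff_lt_or_eq.1 hj with h | rfl
    · refine ih j h z fun k hk => ?_
      have := hz k hk
      rwa [orthogonalize, reduceRows_of_ne (by lia)] at this
    · have h1 : ∀ k < j, dot m z (orthogonalize m M R j k) = 0 := fun k hk => by
        have := hz k hk.le
        rwa [orthogonalize, reduceRows_of_ne (by lia)] at this
      have h2 := hz j le_rfl
      rwa [orthogonalize, dot_reduceRows_of_orthogonal hm le_rfl z h1,
        orthogonalize_of_le le_rfl] at h2

lemma orthogonalize_dot_eq_zero (hm : m ≤ M) {n j p : ℕ} (hp : p < n) (hj : j < p) :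
    dot m (orthogonalize m M R n p) (R j) = 0 :=
  dot_eq_zero_of_orthogonalize hm n j (by lia) _ fun k hk =>
    orthogonalize_orthogonal hm n p hp k (by lia)

/-- The rows of `R` consist of a vector, in the columns `0, …, m - 1`, and of the coefficients of a
representation of this vector by `v 0, …, v (n - 1)`, in the columns `m, …, m + n - 1`.  Only the
vectors `v i` with `α i ≠ 0` are used, the coefficient matrix is lower triangular, and it has the
diagonal `α`. -/
structure IsRepresentation (n m : ℕ) (v : ℕ → ℕ → ℝ) (α : ℕ → ℝ) (R : ℕ → ℕ → ℝ) : Prop where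
  row : ∀ i < n, ∀ l < m, R i l = ∑ i' ∈ range n, R i (m + i') * v i' l
  support : ∀ i < n, ∀ i' < n, α i' = 0 → R i (m + i') = 0
  triangular : ∀ i' < n, ∀ i < i', R i (m + i') = 0
  diagonal : ∀ i < n, R i (m + i) = α i

variable {n : ℕ} {v : ℕ → ℕ → ℝ} {α : ℕ → ℝ}

lemma IsRepresentation.reduceRow (h : IsRepresentation n m v α R) {j k : ℕ} (hj : j < n)
    (hk : k < j) : IsRepresentation n m v α (reduceRow m (n + m) R j k) := by
  have e : ∀ l < n + m, GramSchmidtWalk.reduceRow m (n + m) R j k j l =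
      R j l - dot m (R j) (R k) / dot m (R k) (R k) * R k l := fun l hl => by
    rw [GramSchmidtWalk.reduceRow, if_pos ⟨rfl, hl⟩]
  constructor
  · intro i hi l hl
    by_cases hij : i = j
    · subst hij
      rw [e l (by lia), h.row i hi l hl, h.row k (by lia) l hl, mul_sum, ← sum_sub_distrib]
      refine sum_congr rfl fun i' hi' => ?_
      rw [e _ (by have := mem_range.1 hi'; lia)]
      ring
    · rw [reduceRow_of_ne hij]
      exact h.row i hi l hl
  · intro i hi i' hi' hα
    by_cases hij : i = j
    · subst hij
      rw [e _ (by lia), h.support i hi i' hi' hα, h.support k (by lia) i' hi' hα]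
      ring
    · rw [reduceRow_of_ne hij]
      exact h.support i hi i' hi' hα
  · intro i' hi' i hi
    by_cases hij : i = j
    · subst hij
      rw [e _ (by lia), h.triangular i' hi' i hi, h.triangular i' hi' k (by lia)]
      ring
    · rw [reduceRow_of_ne hij]
      exact h.triangular i' hi' i hi
  · intro i hi
    by_cases hij : i = j
    · subst hij
      rw [e _ (by lia), h.diagonal i hi, h.triangular i hi k hk]
      ring
    · rw [reduceRow_of_ne hij]
      exact h.diagonal i hi

lemma IsRepresentation.reduceRows (h : IsRepresentation n m v α R) {j k : ℕ} (hj : j < n)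
    (hk : k ≤ j) : IsRepresentation n m v α (reduceRows m (n + m) R j k) := by
  induction k with
  | zero => exact h
  | succ k ih => exact (ih (by lia)).reduceRow hj (by lia)

lemma IsRepresentation.orthogonalize (h : IsRepresentation n m v α R) {j : ℕ} (hj : j ≤ n) :
    IsRepresentation n m v α (orthogonalize m (n + m) R j) := by
  induction j with
  | zero => exact h
  | succ j ih => exact (ih (by lia)).reduceRows (by lia) le_rfl

end Orthogonalization

open RealRAM

/-! ### The program -/

/-- `a ⨟ b` executes first `a` and then `b`. -/
infixr:65 " ⨟ " => RealRAM.Prog.seq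

/-- The cell `(0, 0)` of array number `a`, which serves as a real variable; register `3` is always
`0`. -/
def var (a : ℕ) : Ref := ⟨a, 3, 3⟩

/-- Initialization.  Register `2` gets `n + m`, register `4` gets `1`, variables `5` and `14` get
`1` and `-1`, and the coloring in array `2` gets the value `x₀`.  Variable `12` is always `0`. -/
def setup : Prog :=
  .idxAdd 2 0 1 ⨟ .idxConst 4 1 ⨟ .realConst (var 5) 1 ⨟ .realConst (var 14) (-1) ⨟
    forDo 6 0 (.realOp .add ⟨2, 6, 3⟩ ⟨1, 6, 3⟩ (var 12))

/-- Row number `i` (register `6`) of array `3` gets variable `4` times row number `i` of array `0`,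
in the columns `0, …, n + m - 1`. -/
def copyRow : Prog := forDo 9 2 (.realOp .mul ⟨3, 6, 9⟩ (var 4) ⟨0, 6, 9⟩)

/-- If coordinate number `i` (register `6`) is alive, then row number `i` of array `3` gets the
vector `v i` followed by the standard unit vector number `i`, and `i` becomes the pivot
(register `10`); otherwise this row gets `0`. -/
def loadRow : Prog :=
  .realOp .mul (var 6) ⟨2, 6, 3⟩ ⟨2, 6, 3⟩ ⨟
  .ite (.realLt (var 6) (var 5)) (.idxAdd 10 6 3 ⨟ .realConst (var 4) 1) (.realConst (var 4) 0) ⨟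
  copyRow ⨟ .idxAdd 11 1 6 ⨟ .realOp .add ⟨3, 6, 11⟩ (var 4) (var 12)

/-- Set up array `3` and find the pivot. -/
def loadRows : Prog := .idxConst 10 0 ⨟ forDo 6 0 loadRow

/-- Variables `7` and `8` get the inner products, over the columns `0, …, m - 1`, of row `k`
(register `8`) of array `3` with row `j` (register `7`) and with itself. -/
def dotRows : Prog :=
  .realConst (var 7) 0 ⨟ .realConst (var 8) 0 ⨟
  forDo 9 1
    (.realOp .mul (var 6) ⟨3, 7, 9⟩ ⟨3, 8, 9⟩ ⨟ .realOp .add (var 7) (var 7) (var 6) ⨟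
     .realOp .mul (var 6) ⟨3, 8, 9⟩ ⟨3, 8, 9⟩ ⨟ .realOp .add (var 8) (var 8) (var 6))

/-- Subtract variable `7` times row `k` of array `3` from row `j`. -/
def subRow : Prog :=
  forDo 9 2 (.realOp .mul (var 6) (var 7) ⟨3, 8, 9⟩ ⨟ .realOp .sub ⟨3, 7, 9⟩ ⟨3, 7, 9⟩ (var 6))

/-- The program for `reduceRow`. -/
def reduceProg : Prog := dotRows ⨟ .realOp .div (var 7) (var 7) (var 8) ⨟ subRow

/-- The program for `orthogonalize`. -/
def orthProg : Prog := forDo 7 0 (forDo 8 7 reduceProg)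

/-- Variable `9`, which is positive, is lowered to variable `6` if the latter is positive and
smaller; variable `10`, which is negative, is raised to variable `6` if the latter is negative and
larger. -/
def clip : Prog :=
  .ite (.realLt (var 12) (var 6))
    (.ite (.realLt (var 6) (var 9)) (.realOp .add (var 9) (var 6) (var 12)) .skip)
    (.ite (.realLt (var 6) (var 12))
      (.ite (.realLt (var 10) (var 6)) (.realOp .add (var 10) (var 6) (var 12)) .skip) .skip)

/-- Variables `9` and `10` get the largest and the smallest step length that keep the coloring
in the cube. -/
def stepLimits : Prog :=
  .realConst (var 9) 2 ⨟ .realConst (var 10) (-2) ⨟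
  forDo 6 0
    (.idxAdd 11 1 6 ⨟
     .realOp .sub (var 6) (var 5) ⟨2, 6, 3⟩ ⨟ .realOp .div (var 6) (var 6) ⟨3, 10, 11⟩ ⨟ clip ⨟
     .realOp .sub (var 6) (var 14) ⟨2, 6, 3⟩ ⨟ .realOp .div (var 6) (var 6) ⟨3, 10, 11⟩ ⨟ clip)

/-- Compute the step direction (the part of the pivot row of array `3` that starts in column `m`),
the two step lengths, and the probability, in variable `13`, of the positive one. -/
def prepare : Prog :=
  loadRows ⨟ orthProg ⨟ stepLimits ⨟
    .realOp .sub (var 6) (var 10) (var 9) ⨟ .realOp .div (var 13) (var 10) (var 6)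

/-- Move the coloring according to the result of the coin toss in register `12`. -/
def move : Prog :=
  .ite (.idxLt 3 12) (.realOp .add (var 11) (var 9) (var 12))
    (.realOp .add (var 11) (var 10) (var 12)) ⨟
  forDo 6 0
    (.idxAdd 11 1 6 ⨟ .realOp .mul (var 6) (var 11) ⟨3, 10, 11⟩ ⨟
     .realOp .add ⟨2, 6, 3⟩ ⟨2, 6, 3⟩ (var 6))

/-- One step of the walk. -/
def walkStep : Prog := prepare ⨟ .toss 12 (var 13) ⨟ move

/-- The Gram-Schmidt walk: `n` steps, each of which freezes at least one coordinate as long as some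
coordinate is alive. -/
def walk : Prog := setup ⨟ forDo 5 0 walkStep

/-! ### Correctness of the parts of the program -/

/-- The part of the memory that does not change after the initialization. -/
structure Env (n m : ℕ) (v : ℕ → ℕ → ℝ) (s : Memory) : Prop where
  idx0 : s.idx 0 = n
  idx1 : s.idx 1 = m
  idx2 : s.idx 2 = n + m
  idx3 : s.idx 3 = 0
  idx4 : s.idx 4 = 1
  cell0 : s.cell 0 = v
  cell5 : s.cell 5 0 0 = 1
  cell12 : s.cell 12 0 0 = 0
  cell14 : s.cell 14 0 0 = -1

/-- A program that does not write to the part of the memory that `Env` is about. -/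
def KeepsEnv (a : Prog) : Bool :=
  !(a.writesIdx 0 || a.writesIdx 1 || a.writesIdx 2 || a.writesIdx 3 || a.writesIdx 4 ||
    a.writesArr 0 || a.writesArr 5 || a.writesArr 12 || a.writesArr 14)

lemma Env.of_agree {n m : ℕ} {v : ℕ → ℕ → ℝ} {s s' : Memory} (h : Env n m v s) {a : Prog}
    (hA : Agree a s s') (ha : KeepsEnv a = true) : Env n m v s' := by
  simp only [KeepsEnv, Bool.not_eq_true', Bool.or_eq_false_iff] at ha
  obtain ⟨⟨⟨⟨⟨⟨⟨⟨h0, h1⟩, h2⟩, h3⟩, h4⟩, c0⟩, c5⟩, c12⟩, c14⟩ := ha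
  exact ⟨(hA.idx _ h0).trans h.idx0, (hA.idx _ h1).trans h.idx1, (hA.idx _ h2).trans h.idx2,
    (hA.idx _ h3).trans h.idx3, (hA.idx _ h4).trans h.idx4, (hA.cell _ c0).trans h.cell0,
    (congrFun₂ (hA.cell _ c5) 0 0).trans h.cell5, (congrFun₂ (hA.cell _ c12) 0 0).trans h.cell12,
    (congrFun₂ (hA.cell _ c14) 0 0).trans h.cell14⟩

section Correctness

variable {n m : ℕ} {v : ℕ → ℕ → ℝ} {s : Memory}

lemma runs_copyRow (h : Env n m v s) : Runs copyRow s (4 * (n + m) + 3) fun s' =>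
    ∀ i l, s'.cell 3 i l =
      if i = s.idx 6 ∧ l < n + m then s.cell 4 0 0 * v i l else s.cell 3 i l := by
  refine Runs.mono (Runs.forDo (B := 1) (fun t s' => ∀ i l, s'.cell 3 i l =
      if i = s.idx 6 ∧ l < t then s.cell 4 0 0 * v i l else s.cell 3 i l)
    (by decide) (by decide) rfl rfl rfl h.idx4 (by simp [Memory.setIdx]) ?_) (by rw [h.idx2])
    (by rw [h.idx2]; exact fun _ _ => id)
  intro t ht s' hI hk hA
  have hE := h.of_agree hA rfl
  have e6 := hA.idx 6 rfl
  have e4 := congrFun₂ (hA.cell 4 rfl) 0 0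
  refine Runs.assign trivial fun i l => ?_
  simp only [Prog.assign, Memory.set, Memory.setIdx, Memory.get, var, ArithOp.eval, hk, e6, e4,
    hE.idx3, hE.cell0, hI, true_and]
  grind

/-- The indicator function of the coordinates that are alive. -/
def aliveInd (x : ℕ → ℕ → ℝ) (i : ℕ) : ℝ := if x i 0 * x i 0 < 1 then 1 else 0

lemma runs_loadRows (h : Env n m v s) : Runs loadRows s ((4 * (n + m) + 20) * (n + m) + 5) fun s' =>
    (∀ i < n, ∀ l < n + m, s'.cell 3 i l =
      if l = m + i then aliveInd (s.cell 2) i else aliveInd (s.cell 2) i * v i l) ∧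
    (∀ i < n, s.cell 2 i 0 * s.cell 2 i 0 < 1 → i ≤ s'.idx 10) ∧
    (s'.idx 10 = 0 ∨ s'.idx 10 < n ∧ s.cell 2 (s'.idx 10) 0 * s.cell 2 (s'.idx 10) 0 < 1) := by
  refine Runs.assign_seq trivial ?_
  set s₀ := (Prog.idxConst 10 0).assign s with hs₀
  have h₀ : Env n m v s₀ := h.of_agree (agree_setIdx (a := .idxConst 10 0) rfl _ _) rfl
  have hx₀ : s₀.cell 2 = s.cell 2 := rfl
  refine Runs.mono (Runs.forDo (B := 4 * (n + m) + 17) (fun t s' =>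
      (∀ i < t, ∀ l < n + m, s'.cell 3 i l =
        if l = m + i then aliveInd (s.cell 2) i else aliveInd (s.cell 2) i * v i l) ∧
      (∀ i < t, s.cell 2 i 0 * s.cell 2 i 0 < 1 → i ≤ s'.idx 10) ∧
      (s'.idx 10 = 0 ∨ s'.idx 10 < t ∧ s.cell 2 (s'.idx 10) 0 * s.cell 2 (s'.idx 10) 0 < 1))
    (by decide) (by decide) rfl rfl rfl h₀.idx4 ?_ ?_)
    (by rw [h₀.idx0]; gcongr; lia) (by rw [h₀.idx0]; exact fun _ _ => id)
  · refine ⟨by simp, by simp, Or.inl ?_⟩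
    simp [hs₀, Memory.setIdx, Prog.assign]
  intro t ht s' hI hk hA
  rw [h₀.idx0] at ht
  have hE := h₀.of_agree hA rfl
  have ex : s'.cell 2 = s.cell 2 := hA.cell 2 rfl
  obtain ⟨hI1, hI2, hI3⟩ := hI
  refine Runs.assign_seq trivial ?_
  refine Runs.seq (B₁ := 4) (B₂ := 4 * (n + m) + 10)
    (Q := _) (Runs.mono (Q := fun s₁ => s₁.cell 4 0 0 = aliveInd (s.cell 2) t ∧
      s₁.cell 3 = s'.cell 3 ∧ s₁.idx 6 = t ∧ Env n m v s₁ ∧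
      s₁.idx 10 = if s.cell 2 t 0 * s.cell 2 t 0 < 1 then t else s'.idx 10) ?_ le_rfl ?_)
      (by lia)
  · refine Runs.ite (B := 3) (fun hc => ?_) fun hc => ?_
    · simp [Test.Holds, Prog.assign, Memory.set, Memory.get, var, ArithOp.eval, hE.idx3,
        hE.cell5, hk, ex] at hc
      refine Runs.assign_seq trivial (Runs.assign trivial ?_)
      refine ⟨?_, ?_, ?_, ?_, ?_⟩
      · simp [Prog.assign, Memory.set, Memory.setIdx, var, hE.idx3, aliveInd, hc]
      · simp [Prog.assign, Memory.set, Memory.setIdx, var]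
      · simp [Prog.assign, Memory.set, Memory.setIdx, hk]
      · constructor <;> simp [Prog.assign, Memory.set, Memory.setIdx, var, hE.idx0, hE.idx1,
          hE.idx2, hE.idx3, hE.idx4, hE.cell0, hE.cell5, hE.cell12, hE.cell14]
      · simp [Prog.assign, Memory.set, Memory.setIdx, var, hE.idx3, hc, hk]
    · simp [Test.Holds, Prog.assign, Memory.set, Memory.get, var, ArithOp.eval, hE.idx3,
        hE.cell5, hk, ex] at hc
      refine Runs.assign trivial ?_
      refine ⟨?_, ?_, ?_, ?_, ?_⟩
      · simp [Prog.assign, Memory.set, var, hE.idx3, aliveInd, hc]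
      · simp [Prog.assign, Memory.set, var]
      · simp [Prog.assign, Memory.set, hk]
      · constructor <;> simp [Prog.assign, Memory.set, var, hE.idx0, hE.idx1,
          hE.idx2, hE.idx3, hE.idx4, hE.cell0, hE.cell5, hE.cell12, hE.cell14]
      · simp [Prog.assign, Memory.set, var, hc]
  rintro s₁ - ⟨f1, f2, f3, f4, f5⟩
  refine Runs.seq (Runs.mono (runs_copyRow f4) le_rfl fun s₂ hA₂ hs₂ => ?_) (B₂ := 3) (by lia)
  have hE₂ := f4.of_agree hA₂ rfl
  have g4 := congrFun₂ (hA₂.cell 4 rfl) 0 0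
  have g6 := hA₂.idx 6 rfl
  have g10 := hA₂.idx 10 rfl
  refine Runs.assign_seq trivial (Runs.assign trivial ⟨?_, ?_, ?_⟩)
  · intro i hi l hl
    simp only [Prog.assign, Memory.set, Memory.setIdx, Memory.get, var, ArithOp.eval,
      Function.update_apply, Nat.reduceEqDiff, if_true, if_false, hE₂.idx3,
      hE₂.idx1, hE₂.cell12, g4, g6, f1, f3, hs₂, f2, true_and, add_zero]
    rcases Nat.lt_succ_iff_lt_or_eq.1 hi with hi | rfl
    · rw [if_neg (by lia), if_neg (by lia), hI1 i hi l hl]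
    · simp [hl]
  · intro i hi hix
    simp only [Prog.assign, Memory.set, Memory.setIdx, Function.update_apply, Nat.reduceEqDiff, if_false, g10, f5]
    rcases Nat.lt_succ_iff_lt_or_eq.1 hi with hi | rfl
    · have := hI2 i hi hix
      split_ifs <;> lia
    · rw [if_pos hix]
  · simp only [Prog.assign, Memory.set, Memory.setIdx, Function.update_apply, Nat.reduceEqDiff, if_false, g10, f5]
    split_ifs with hx
    · exact Or.inr ⟨by lia, hx⟩
    · exact hI3.imp id fun h => ⟨by lia, h.2⟩

lemma runs_dotRows (h : Env n m v s) :
    Runs dotRows s (10 * (n + m) + 7) fun s' =>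
      s'.cell 7 0 0 = dot m (s.cell 3 (s.idx 7)) (s.cell 3 (s.idx 8)) ∧
      s'.cell 8 0 0 = dot m (s.cell 3 (s.idx 8)) (s.cell 3 (s.idx 8)) := by
  refine Runs.assign_seq trivial (Runs.assign_seq trivial ?_)
  set s₀ := (Prog.realConst (var 8) 0).assign ((Prog.realConst (var 7) 0).assign s) with hs₀
  have h₀ : Env n m v s₀ := h.of_agree
    ((agree_set (a := dotRows) (z := var 7) rfl s ((0 : ℤ) : ℝ)).trans
      (agree_set (z := var 8) rfl _ ((0 : ℤ) : ℝ))) rfl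
  have e3 : s₀.cell 3 = s.cell 3 := by simp [hs₀, Prog.assign, Memory.set, var]
  have e7 : s₀.idx 7 = s.idx 7 := rfl
  have e8 : s₀.idx 8 = s.idx 8 := rfl
  refine Runs.mono (Runs.forDo (B := 7) (fun t s' =>
      s'.cell 7 0 0 = dot t (s.cell 3 (s.idx 7)) (s.cell 3 (s.idx 8)) ∧
      s'.cell 8 0 0 = dot t (s.cell 3 (s.idx 8)) (s.cell 3 (s.idx 8)))
    (by decide) (by decide) rfl rfl rfl h₀.idx4 ?_ ?_) (by rw [h₀.idx1]; lia)
    (by rw [h₀.idx1]; exact fun _ _ => id)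
  · simp [hs₀, Prog.assign, Memory.set, Memory.setIdx, var, dot, h.idx3]
  intro t ht s' hI hk hA
  have hE := h₀.of_agree hA rfl
  have f3 : s'.cell 3 = s.cell 3 := (hA.cell 3 rfl).trans e3
  have f7 : s'.idx 7 = s.idx 7 := hA.idx 7 rfl
  have f8 : s'.idx 8 = s.idx 8 := hA.idx 8 rfl
  refine Runs.assign_seq trivial (Runs.assign_seq trivial (Runs.assign_seq trivial
    (Runs.assign trivial ?_)))
  rw [dot, dot, Finset.sum_range_succ, Finset.sum_range_succ, ← dot, ← dot, ← hI.1, ← hI.2]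
  simp [Prog.assign, Memory.set, Memory.setIdx, Memory.get, ArithOp.eval, var, hE.idx3, f3, f7, f8,
    hk]

lemma runs_subRow (h : Env n m v s) (hjk : s.idx 8 < s.idx 7) :
    Runs subRow s (6 * (n + m) + 3) fun s' => ∀ i l, s'.cell 3 i l =
      if i = s.idx 7 ∧ l < n + m then
        s.cell 3 (s.idx 7) l - s.cell 7 0 0 * s.cell 3 (s.idx 8) l else s.cell 3 i l := by
  refine Runs.mono (Runs.forDo (B := 3) (fun t s' => ∀ i l, s'.cell 3 i l =
      if i = s.idx 7 ∧ l < t then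
        s.cell 3 (s.idx 7) l - s.cell 7 0 0 * s.cell 3 (s.idx 8) l else s.cell 3 i l)
    (by decide) (by decide) rfl rfl rfl h.idx4 (by simp [Memory.setIdx]) ?_)
    (by rw [h.idx2]) (by rw [h.idx2]; exact fun _ _ => id)
  intro t ht s' hI hk hA
  have hE := h.of_agree hA rfl
  have e7 := hA.idx 7 rfl
  have e8 := hA.idx 8 rfl
  have c7 := congrFun₂ (hA.cell 7 rfl) 0 0
  have hne : s.idx 8 ≠ s.idx 7 := hjk.ne
  refine Runs.assign_seq trivial (Runs.assign trivial fun i l => ?_)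
  simp only [Prog.assign, Memory.set, Memory.setIdx, Memory.get, var, ArithOp.eval, hk, e7, e8, c7,
    hE.idx3, hI, true_and, false_and, Nat.reduceEqDiff, if_false, if_true, hne]
  grind

lemma runs_reduceProg (h : Env n m v s) (hjk : s.idx 8 < s.idx 7) :
    Runs reduceProg s (16 * (n + m) + 13) fun s' =>
      s'.cell 3 = reduceRow m (n + m) (s.cell 3) (s.idx 7) (s.idx 8) := by
  refine Runs.seq (Runs.mono (runs_dotRows h) le_rfl fun s₁ hA ⟨h7, h8⟩ => ?_)
    (B₂ := 6 * (n + m) + 3 + 2) (by lia)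
  refine Runs.assign_seq trivial ?_
  have hE := h.of_agree hA rfl
  have hE' := hE.of_agree (agree_set (a := reduceProg) (z := var 7) rfl s₁
    (ArithOp.div.eval (s₁.get (var 7)) (s₁.get (var 8)))) rfl
  have e7 := hA.idx 7 rfl
  have e8 := hA.idx 8 rfl
  have e3 := hA.cell 3 rfl
  refine Runs.mono (runs_subRow hE' (by simpa [Prog.assign, Memory.set, e7, e8])) le_rfl fun s₂ hA₂ hs₂ => ?_
  funext i l
  rw [hs₂, reduceRow]
  simp [Prog.assign, Memory.set, Memory.get, var, ArithOp.eval, e7, e8, e3, h7, h8, hE.idx3]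

lemma runs_orthProg (h : Env n m v s) :
    Runs orthProg s (((16 * (n + m) + 16) * (n + m) + 6) * (n + m) + 3) fun s' =>
      s'.cell 3 = orthogonalize m (n + m) (s.cell 3) n := by
  refine Runs.mono (Runs.forDo (B := (16 * (n + m) + 16) * (n + m) + 3)
      (fun t s' => s'.cell 3 = orthogonalize m (n + m) (s.cell 3) t)
    (by decide) (by decide) rfl rfl rfl h.idx4 rfl ?_)
    (by rw [h.idx0]; gcongr; lia) (by rw [h.idx0]; exact fun _ _ => id)
  intro j hj s' hI hk hA
  rw [h.idx0] at hj
  have hE := h.of_agree hA rfl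
  refine Runs.mono (Runs.forDo (B := 16 * (n + m) + 13)
      (fun t s'' => s''.cell 3 = reduceRows m (n + m) (s'.cell 3) j t)
    (by decide) (by decide) rfl rfl rfl hE.idx4 rfl ?_)
    (by rw [hk]; gcongr; lia) (by rw [hk, hI]; exact fun _ _ => id)
  intro k hk' s'' hI' hk'' hA'
  rw [hk] at hk'
  have e7 := hA'.idx 7 rfl
  refine Runs.mono (runs_reduceProg (hE.of_agree hA' rfl) (by rw [hk'', e7, hk]; exact hk'))
    le_rfl fun s₃ _ hs₃ => ?_
  rw [hI', e7, hk, hk''] at hs₃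
  exact hs₃

/-- `H` is positive and at most every positive number that satisfies `C`, and it is `2` or one of
these numbers; symmetrically, `L` is negative and at least every negative number that satisfies `C`,
and it is `-2` or one of these. -/
structure IsLimits (C : ℝ → Prop) (H L : ℝ) : Prop where
  hi_pos : 0 < H
  lo_neg : L < 0
  hi_le : ∀ c, C c → 0 < c → H ≤ c
  le_lo : ∀ c, C c → c < 0 → c ≤ L
  hi_eq : H = 2 ∨ C H
  lo_eq : L = -2 ∨ C L

lemma IsLimits.congr {C C' : ℝ → Prop} {H L : ℝ} (h : IsLimits C H L) (hC : ∀ c, C c ↔ C' c) :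
    IsLimits C' H L := by
  obtain rfl : C = C' := funext fun c => propext (hC c)
  exact h

lemma runs_clip (h : Env n m v s) {C : ℝ → Prop}
    (hC : IsLimits C (s.cell 9 0 0) (s.cell 10 0 0)) : Runs clip s 4 fun s' =>
      IsLimits (fun c => C c ∨ c = s.cell 6 0 0) (s'.cell 9 0 0) (s'.cell 10 0 0) := by
  obtain ⟨h1, h2, h3, h4, h5, h6⟩ := hC
  refine Runs.ite (B := 3) (fun hc => ?_) fun hc => ?_
  · simp only [Test.Holds, Memory.get, var, h.idx3, h.cell12] at hc
    refine Runs.ite (B := 2) (fun hc' => ?_) fun hc' => ?_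
    · simp only [Test.Holds, Memory.get, var, h.idx3] at hc'
      refine Runs.assign trivial ?_
      simp only [Prog.assign, Memory.set, Memory.get, var, h.idx3, h.cell12, ArithOp.eval,
        and_self, if_true, add_zero, Nat.reduceEqDiff, false_and, if_false]
      constructor <;> grind
    · simp only [Test.Holds, Memory.get, var, h.idx3] at hc'
      refine Runs.assign trivial ?_
      simp only [Prog.assign]
      constructor <;> grind
  · simp only [Test.Holds, Memory.get, var, h.idx3, h.cell12] at hc
    refine Runs.ite (B := 2) (fun hc' => ?_) fun hc' => ?_
    · simp only [Test.Holds, Memory.get, var, h.idx3, h.cell12] at hc'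
      refine Runs.ite (B := 1) (fun hc'' => ?_) fun hc'' => ?_
      · simp only [Test.Holds, Memory.get, var, h.idx3] at hc''
        refine Runs.assign trivial ?_
        simp only [Prog.assign, Memory.set, Memory.get, var, h.idx3, h.cell12, ArithOp.eval,
          and_self, if_true, add_zero, Nat.reduceEqDiff, false_and, if_false]
        constructor <;> grind
      · simp only [Test.Holds, Memory.get, var, h.idx3] at hc''
        refine Runs.assign trivial ?_
        simp only [Prog.assign]
        constructor <;> grind
    · simp only [Test.Holds, Memory.get, var, h.idx3, h.cell12] at hc'
      refine Runs.assign trivial ?_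
      simp only [Prog.assign]
      constructor <;> grind

/-- The step lengths at which one of the coordinates number `0, …, t - 1` of `x + δ * u` reaches
`1` or `-1`. -/
def IsHit (x u : ℕ → ℝ) (t : ℕ) (c : ℝ) : Prop :=
  ∃ i < t, c = (1 - x i) / u i ∨ c = (-1 - x i) / u i

lemma isHit_succ (x u : ℕ → ℝ) (t : ℕ) (c : ℝ) : IsHit x u (t + 1) c ↔
    (IsHit x u t c ∨ c = (1 - x t) / u t) ∨ c = (-1 - x t) / u t := by
  simp only [IsHit, Nat.lt_succ_iff_lt_or_eq]
  grind

lemma runs_stepLimits (h : Env n m v s) : Runs stepLimits s (22 * (n + m) + 7) fun s' =>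
    IsLimits (IsHit (fun i => s.cell 2 i 0) (fun i => s.cell 3 (s.idx 10) (m + i)) n)
      (s'.cell 9 0 0) (s'.cell 10 0 0) := by
  refine Runs.assign_seq trivial (Runs.assign_seq trivial ?_)
  set s₀ := (Prog.realConst (var 10) (-2)).assign ((Prog.realConst (var 9) 2).assign s) with hs₀
  have hA₀ : Agree stepLimits s s₀ := (agree_set (z := var 9) rfl s ((2 : ℤ) : ℝ)).trans
      (agree_set (z := var 10) rfl _ ((-2 : ℤ) : ℝ))
  have h₀ : Env n m v s₀ := h.of_agree hA₀ rfl
  refine Runs.mono (Runs.forDo (B := 19) (fun t s' =>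
      IsLimits (IsHit (fun i => s.cell 2 i 0) (fun i => s.cell 3 (s.idx 10) (m + i)) t)
        (s'.cell 9 0 0) (s'.cell 10 0 0))
    (by decide) (by decide) rfl rfl rfl h₀.idx4 ?_ ?_) (by rw [h₀.idx0]; lia)
    (by rw [h₀.idx0]; exact fun _ _ => id)
  · simp only [hs₀, Prog.assign, Memory.set, Memory.setIdx, var, h.idx3, and_self, if_true,
      Nat.reduceEqDiff, false_and, if_false]
    constructor <;> simp [IsHit]
  intro t ht s' hI hk hA
  have hE := h₀.of_agree hA rfl
  have e2 : s'.cell 2 = s.cell 2 := (hA.cell 2 rfl).trans (hA₀.cell 2 rfl)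
  have e3 : s'.cell 3 = s.cell 3 := (hA.cell 3 rfl).trans (hA₀.cell 3 rfl)
  have e10 : s'.idx 10 = s.idx 10 := (hA.idx 10 rfl).trans (hA₀.idx 10 rfl)
  refine Runs.assign_seq trivial (Runs.assign_seq trivial (Runs.assign_seq trivial ?_))
  set s₁ := (Prog.realOp .div (var 6) (var 6) ⟨3, 10, 11⟩).assign
    ((Prog.realOp .sub (var 6) (var 5) ⟨2, 6, 3⟩).assign ((Prog.idxAdd 11 1 6).assign s'))
    with hs₁
  have hA₁ : Agree stepLimits s' s₁ := ((agree_setIdx (k := 11) rfl _ _).trans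
    (agree_set (z := var 6) rfl _ _)).trans (agree_set (z := var 6) rfl _ _)
  have c6 : s₁.cell 6 0 0 = (1 - s.cell 2 t 0) / s.cell 3 (s.idx 10) (m + t) := by
    simp [hs₁, Prog.assign, Memory.set, Memory.setIdx, Memory.get, var, ArithOp.eval, hE.idx3,
      hE.cell5, hE.idx1, e2, e3, e10, hk]
  have i11 : s₁.idx 11 = m + t := by
    simp [hs₁, Prog.assign, Memory.set, Memory.setIdx, hE.idx1, hk]
  have i6 : s₁.idx 6 = t := by simp [hs₁, Prog.assign, Memory.set, Memory.setIdx, hk]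
  have hI₁ : IsLimits (IsHit (fun i => s.cell 2 i 0) (fun i => s.cell 3 (s.idx 10) (m + i)) t)
      (s₁.cell 9 0 0) (s₁.cell 10 0 0) := by
    simpa [hs₁, Prog.assign, Memory.set, Memory.setIdx, var] using hI
  refine Runs.seq (Runs.mono (runs_clip (hE.of_agree hA₁ rfl) hI₁) le_rfl
    fun s₂ hA₂ hI₂ => ?_) (B₂ := 8) (by lia)
  have hE₂ := (hE.of_agree hA₁ rfl).of_agree hA₂ rfl
  have f2 : s₂.cell 2 = s.cell 2 := (hA₂.cell 2 rfl).trans ((hA₁.cell 2 rfl).trans e2)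
  have f3 : s₂.cell 3 = s.cell 3 := (hA₂.cell 3 rfl).trans ((hA₁.cell 3 rfl).trans e3)
  have f10 : s₂.idx 10 = s.idx 10 := (hA₂.idx 10 rfl).trans ((hA₁.idx 10 rfl).trans e10)
  have f11 : s₂.idx 11 = m + t := (hA₂.idx 11 rfl).trans i11
  have f6 : s₂.idx 6 = t := (hA₂.idx 6 rfl).trans i6
  refine Runs.assign_seq trivial (Runs.assign_seq trivial ?_)
  set s₃ := (Prog.realOp .div (var 6) (var 6) ⟨3, 10, 11⟩).assign
    ((Prog.realOp .sub (var 6) (var 14) ⟨2, 6, 3⟩).assign s₂) with hs₃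
  have hA₃ : Agree stepLimits s₂ s₃ := (agree_set (z := var 6) rfl _ _).trans
    (agree_set (z := var 6) rfl _ _)
  have c6' : s₃.cell 6 0 0 = (-1 - s.cell 2 t 0) / s.cell 3 (s.idx 10) (m + t) := by
    simp [hs₃, Prog.assign, Memory.set, Memory.get, var, ArithOp.eval, hE₂.idx3,
      hE₂.cell14, f2, f3, f10, f11, f6]
  rw [← show s₃.cell 9 = s₂.cell 9 by simp [hs₃, Prog.assign, Memory.set, var],
    ← show s₃.cell 10 = s₂.cell 10 by simp [hs₃, Prog.assign, Memory.set, var]] at hI₂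
  refine Runs.mono (runs_clip (hE₂.of_agree hA₃ rfl) hI₂) le_rfl fun s₄ hA₄ hI₄ => ?_
  rw [c6, c6'] at hI₄
  exact hI₄.congr fun c => (isHit_succ _ _ _ _).symm

/-- What one execution of `prepare` computes from the coloring in `s`: the pivot `p`, the step
direction `u`, the two step lengths, and the probability of the positive one. -/
structure Prepared (n m : ℕ) (v : ℕ → ℕ → ℝ) (s s' : Memory) : Prop where
  env : Env n m v s'
  coloring_eq : s'.cell 2 = s.cell 2
  counter : s'.idx 5 = s.idx 5
  pivot_lt : s'.idx 10 < n
  le_pivot : ∀ i < n, s.cell 2 i 0 * s.cell 2 i 0 < 1 → i ≤ s'.idx 10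
  pivot_alive : ∀ i < n, s.cell 2 i 0 * s.cell 2 i 0 < 1 →
    s.cell 2 (s'.idx 10) 0 * s.cell 2 (s'.idx 10) 0 < 1
  direction_pivot : s'.cell 3 (s'.idx 10) (m + s'.idx 10) = aliveInd (s.cell 2) (s'.idx 10)
  direction_frozen : ∀ i < n, ¬ s.cell 2 i 0 * s.cell 2 i 0 < 1 →
    s'.cell 3 (s'.idx 10) (m + i) = 0
  orthogonal : ∀ j < s'.idx 10, s.cell 2 j 0 * s.cell 2 j 0 < 1 →
    ∑ l ∈ Finset.range m, (∑ i ∈ Finset.range n, s'.cell 3 (s'.idx 10) (m + i) * v i l) * v j l = 0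
  limits : IsLimits (IsHit (fun i => s.cell 2 i 0) (fun i => s'.cell 3 (s'.idx 10) (m + i)) n)
    (s'.cell 9 0 0) (s'.cell 10 0 0)
  bias : s'.cell 13 0 0 = s'.cell 10 0 0 / (s'.cell 10 0 0 - s'.cell 9 0 0)

lemma isRepresentation_of_load {R x : ℕ → ℕ → ℝ} (hv : ∀ i < n, ∀ l, m ≤ l → v i l = 0)
    (hR : ∀ i < n, ∀ l < n + m, R i l =
      if l = m + i then aliveInd x i else aliveInd x i * v i l) :
    IsRepresentation n m v (aliveInd x) R := by
  have e : ∀ i < n, ∀ i' < n, R i (m + i') = if i' = i then aliveInd x i else 0 := by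
    intro i hi i' hi'
    rw [hR i hi _ (by lia), hv i hi (m + i') (by lia), mul_zero]
    simp
  constructor
  · intro i hi l hl
    rw [Finset.sum_congr rfl fun i' hi' => by rw [e i hi i' (Finset.mem_range.1 hi')],
      hR i hi l (by lia), if_neg (by lia)]
    simp [hi]
  · intro i hi i' hi' hα
    rw [e i hi i' hi']
    split_ifs with h
    · rw [← h, hα]
    · rfl
  · intro i' hi' i hi
    rw [e i (by lia) i' hi', if_neg (by lia)]
  · intro i hi
    rw [e i hi i hi, if_pos rfl]

lemma runs_prepare (h : Env n m v s) (hn : 0 < n) (hv : ∀ i < n, ∀ l, m ≤ l → v i l = 0) :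
    Runs prepare s (100 * (n + m + 1) ^ 3) (Prepared n m v s) := by
  refine Runs.seq (Runs.mono (runs_loadRows h) le_rfl fun s₁ hA₁ ⟨hR, hp1, hp2⟩ => ?_)
    (B₂ := (((16 * (n + m) + 16) * (n + m) + 6) * (n + m) + 3) + (22 * (n + m) + 7 + 3 + 1) + 1)
    (by ring_nf; nlinarith)
  have hE₁ := h.of_agree hA₁ rfl
  refine Runs.seq (Runs.mono (runs_orthProg hE₁) le_rfl fun s₂ hA₂ hs₂ => ?_) le_rfl
  have hE₂ := hE₁.of_agree hA₂ rfl
  refine Runs.seq (Runs.mono (runs_stepLimits hE₂) le_rfl fun s₃ hA₃ hs₃ => ?_)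
    (B₂ := 3) le_rfl
  have hE₃ := hE₂.of_agree hA₃ rfl
  refine Runs.assign_seq trivial (Runs.assign trivial ?_)
  set s₄ := (Prog.realOp .div (var 13) (var 10) (var 6)).assign
    ((Prog.realOp .sub (var 6) (var 10) (var 9)).assign s₃) with hs₄
  have hA₄ : Agree (.seq (.realOp .sub (var 6) (var 10) (var 9))
      (.realOp .div (var 13) (var 10) (var 6))) s₃ s₄ :=
    (agree_set (z := var 6) rfl _ _).trans (agree_set (z := var 13) rfl _ _)
  have hE₄ := hE₃.of_agree hA₄ rfl
  have e2 : s₂.cell 2 = s.cell 2 := (hA₂.cell 2 rfl).trans (hA₁.cell 2 rfl)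
  have e10 : s₄.idx 10 = s₁.idx 10 :=
    (hA₄.idx 10 rfl).trans ((hA₃.idx 10 rfl).trans (hA₂.idx 10 rfl))
  have e3 : s₄.cell 3 = orthogonalize m (n + m) (s₁.cell 3) n :=
    (hA₄.cell 3 rfl).trans ((hA₃.cell 3 rfl).trans hs₂)
  have hrep := (isRepresentation_of_load hv hR).orthogonalize le_rfl
  have hpn : s₁.idx 10 < n := hp2.elim (fun h => h ▸ hn) fun h => h.1
  have c9 : s₄.cell 9 = s₃.cell 9 := hA₄.cell 9 rfl
  have c10 : s₄.cell 10 = s₃.cell 10 := hA₄.cell 10 rfl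
  refine ⟨hE₄, ?_, ?_, ?_, ?_, ?_, ?_, ?_, ?_, ?_, ?_⟩
  · exact (hA₄.cell 2 rfl).trans ((hA₃.cell 2 rfl).trans e2)
  · exact (hA₄.idx 5 rfl).trans
      ((hA₃.idx 5 rfl).trans ((hA₂.idx 5 rfl).trans (hA₁.idx 5 rfl)))
  · rwa [e10]
  · rwa [e10]
  · rw [e10]
    rcases hp2 with h0 | h0
    · intro i hi hx
      have := hp1 i hi hx
      rw [h0] at this ⊢
      rwa [Nat.le_zero.1 this] at hx
    · exact fun _ _ _ => h0.2
  · rw [e10, e3]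
    exact hrep.diagonal _ hpn
  · intro i hi hx
    rw [e10, e3]
    exact hrep.support _ hpn i hi (if_neg hx)
  · intro j hj hx
    rw [e10, e3] at *
    have h1 := orthogonalize_dot_eq_zero (R := s₁.cell 3) (Nat.le_add_left m n) hpn hj
    rw [← h1, dot]
    refine Finset.sum_congr rfl fun l hl => ?_
    have hl := Finset.mem_range.1 hl
    rw [hrep.row _ hpn l hl, hR j (by lia) l (by lia), if_neg (by lia), aliveInd, if_pos hx, one_mul]
  · rw [c9, c10, e10, e3, ← hs₂, ← hA₂.idx 10 rfl, ← e2]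
    exact hs₃
  · simp [hs₄, Prog.assign, Memory.set, Memory.get, var, ArithOp.eval, hE₃.idx3]

lemma runs_move (h : Env n m v s) : Runs move s (8 * (n + m) + 6) fun s' =>
    ∀ i < n, s'.cell 2 i 0 = s.cell 2 i 0 +
      (if 0 < s.idx 12 then s.cell 9 0 0 else s.cell 10 0 0) * s.cell 3 (s.idx 10) (m + i) := by
  set δ := if 0 < s.idx 12 then s.cell 9 0 0 else s.cell 10 0 0 with hδ
  refine Runs.seq (B₁ := 2) (B₂ := 8 * (n + m) + 3) (Runs.mono (Q := fun s₁ =>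
    s₁.cell 11 0 0 = δ) ?_ le_rfl fun s₁ hA₁ hs₁ => ?_) (by lia)
  · refine Runs.ite (B := 1) (fun hc => ?_) fun hc => ?_
    all_goals
      simp only [Test.Holds, h.idx3] at hc
      refine Runs.assign trivial ?_
      simp [Prog.assign, Memory.set, Memory.get, var, ArithOp.eval, h.idx3, h.cell12, hδ, hc]
  have hE₁ := h.of_agree hA₁ rfl
  have e2 := hA₁.cell 2 rfl
  have e3 := hA₁.cell 3 rfl
  have e10 := hA₁.idx 10 rfl
  refine Runs.mono (Runs.forDo (B := 5) (fun t s' => ∀ i, s'.cell 2 i 0 =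
      if i < t then s.cell 2 i 0 + δ * s.cell 3 (s.idx 10) (m + i) else s.cell 2 i 0)
    (by decide) (by decide) rfl rfl rfl hE₁.idx4 (by simp [Memory.setIdx, e2]) ?_)
    (by rw [hE₁.idx0]; lia) (by rw [hE₁.idx0]; exact fun _ _ h i hi => by rw [h, if_pos hi])
  intro t ht s' hI hk hA
  have hE := hE₁.of_agree hA rfl
  have f3 : s'.cell 3 = s.cell 3 := (hA.cell 3 rfl).trans e3
  have f10 : s'.idx 10 = s.idx 10 := (hA.idx 10 rfl).trans e10
  have f11 : s'.cell 11 0 0 = δ := (congrFun₂ (hA.cell 11 rfl) 0 0).trans hs₁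
  refine Runs.assign_seq trivial (Runs.assign_seq trivial (Runs.assign trivial fun i => ?_))
  have h1 := hI i
  have h2 := hI t
  simp only [lt_self_iff_false, if_false] at h2
  simp only [Prog.assign, Memory.set, Memory.setIdx, Memory.get, var, ArithOp.eval,
    Function.update_apply, Nat.reduceEqDiff, if_true, if_false, hk, f3, f10, f11, hE.idx3, hE.idx1,
    true_and, false_and, and_true, h1, h2]
  grind

lemma runs_setup (h0 : s.idx 0 = n) (h1 : s.idx 1 = m) (h3 : s.idx 3 = 0) (h12 : s.cell 12 0 0 = 0) :
    Runs setup s (4 * (n + m) + 11) fun s' =>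
      Env n m (s.cell 0) s' ∧ ∀ i < n, s'.cell 2 i 0 = s.cell 1 i 0 := by
  refine Runs.assign_seq trivial (Runs.assign_seq trivial (Runs.assign_seq trivial
    (Runs.assign_seq trivial ?_)))
  set s₁ := (Prog.realConst (var 14) (-1)).assign ((Prog.realConst (var 5) 1).assign
    ((Prog.idxConst 4 1).assign ((Prog.idxAdd 2 0 1).assign s))) with hs₁
  have hE₁ : Env n m (s.cell 0) s₁ := by
    constructor <;> simp [hs₁, Prog.assign, Memory.set, Memory.setIdx, var, h0, h1, h3, h12]
  have e1 : s₁.cell 1 = s.cell 1 := by simp [hs₁, Prog.assign, Memory.set, Memory.setIdx, var]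
  refine Runs.mono (Runs.forDo (B := 1) (fun t s' => ∀ i < t, s'.cell 2 i 0 = s.cell 1 i 0)
    (by decide) (by decide) rfl rfl rfl hE₁.idx4 (by simp) ?_) (by rw [hE₁.idx0]; lia)
    (by rw [hE₁.idx0]; exact fun s' hA h => ⟨hE₁.of_agree hA rfl, h⟩)
  intro t ht s' hI hk hA
  have hE := hE₁.of_agree hA rfl
  have f1 : s'.cell 1 = s.cell 1 := (hA.cell 1 rfl).trans e1
  refine Runs.assign trivial fun i hi => ?_
  simp only [Prog.assign, Memory.set, Memory.setIdx, Memory.get, var, ArithOp.eval, hk, f1,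
    hE.idx3, hE.cell12, true_and, and_true, add_zero]
  rcases Nat.lt_succ_iff_lt_or_eq.1 hi with hi | rfl
  · rw [if_neg (by lia), hI i hi]
  · rw [if_pos rfl]

end Correctness

open scoped ENNReal

/-! ### The walk -/

section Walk

variable {n m : ℕ}

/-- A step length in the direction `u` that does not overshoot the first hit of `1` or `-1`. -/
lemma abs_add_mul_le_one {x u t : ℝ} (hx : |x| ≤ 1) (hu : u ≠ 0 → |x| < 1) (ht : 0 < t)
    (h1 : 0 < (1 - x) / u → t ≤ (1 - x) / u) (h2 : 0 < (-1 - x) / u → t ≤ (-1 - x) / u) :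
    |x + t * u| ≤ 1 := by
  rcases lt_trichotomy u 0 with hu0 | rfl | hu0
  · obtain ⟨h3, h4⟩ := abs_lt.1 (hu hu0.ne)
    have h5 := h2 (div_pos_of_neg_of_neg (by linarith) hu0)
    rw [le_div_iff_of_neg hu0] at h5
    rw [abs_le]
    constructor <;> nlinarith
  · simpa using hx
  · obtain ⟨h3, h4⟩ := abs_lt.1 (hu hu0.ne')
    have h5 := h1 (div_pos (by linarith) hu0)
    rw [le_div_iff₀ hu0] at h5
    rw [abs_le]
    constructor <;> nlinarith

/-- After a step whose length is the first hit, fewer coordinates are alive. -/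
lemma card_alive_lt {x u : Fin n → ℝ} (hu : ∀ i, i ∉ alive x → u i = 0) {t : ℝ} (ht : t ≠ 0)
    {i : Fin n} (hi : t = (1 - x i) / u i ∨ t = (-1 - x i) / u i) :
    (alive fun i => x i + t * u i).card < (alive x).card := by
  refine Finset.card_lt_card ⟨fun j hj => ?_, fun h => ?_⟩
  · by_contra hjx
    refine hjx (mem_alive.2 ?_)
    simpa [hu j hjx] using mem_alive.1 hj
  · have hui : u i ≠ 0 := by
      intro h0
      simp [h0, ht] at hi
    have hia : i ∈ alive x := by
      by_contra h0
      exact hui (hu i h0)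
    have h1 := mem_alive.1 (h hia)
    rcases hi with rfl | rfl <;>
    · rw [div_mul_cancel₀ _ hui] at h1
      norm_num at h1

/-- The array that holds the vectors `v i` as its rows. -/
def vecArray (v : Fin n → EuclideanSpace ℝ (Fin m)) (i j : ℕ) : ℝ :=
  if h : i < n ∧ j < m then v ⟨i, h.1⟩ ⟨j, h.2⟩ else 0

/-- The coloring in the memory. -/
def coloring (n : ℕ) (s : Memory) (i : Fin n) : ℝ := s.cell 2 i 0

/-- The step direction in the memory. -/
def direction (n m : ℕ) (s : Memory) (i : Fin n) : ℝ := s.cell 3 (s.idx 10) (m + i)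

variable {v : Fin n → EuclideanSpace ℝ (Fin m)} {s s' : Memory}

lemma mem_alive_coloring {i : Fin n} :
    i ∈ alive (coloring n s) ↔ s.cell 2 i 0 * s.cell 2 i 0 < 1 := by
  rw [mem_alive, coloring, ← sq_lt_one_iff_abs_lt_one, sq]

lemma Prepared.direction_eq_zero (h : Prepared n m (vecArray v) s s') :
    ∀ i, i ∉ alive (coloring n s) → direction n m s' i = 0 := fun i hi =>
  h.direction_frozen i i.2 fun h => hi (mem_alive_coloring.2 h)

lemma Prepared.isPivot (h : Prepared n m (vecArray v) s s') (ha : (alive (coloring n s)).Nonempty) :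
    IsPivot (coloring n s) ⟨s'.idx 10, h.pivot_lt⟩ := by
  obtain ⟨i, hi⟩ := ha
  refine ⟨mem_alive_coloring.2 (h.pivot_alive i i.2 (mem_alive_coloring.1 hi)), fun j hj => ?_⟩
  exact h.le_pivot j j.2 (mem_alive_coloring.1 hj)

lemma Prepared.isStepDirection (h : Prepared n m (vecArray v) s s')
    (ha : (alive (coloring n s)).Nonempty) :
    IsStepDirection v (coloring n s) ⟨s'.idx 10, h.pivot_lt⟩ (direction n m s') := by
  have hp := h.isPivot ha
  refine ⟨?_, h.direction_eq_zero, fun j hj hjp => ?_⟩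
  · rw [direction, h.direction_pivot, aliveInd, if_pos (mem_alive_coloring.1 hp.1)]
  · have hlt : (j : ℕ) < s'.idx 10 := lt_of_le_of_ne (hp.2 hj) fun e => hjp (Fin.ext e)
    rw [← h.orthogonal j hlt (mem_alive_coloring.1 hj), Finset.sum_range, PiLp.inner_apply]
    refine Finset.sum_congr rfl fun l _ => ?_
    rw [Finset.sum_range]
    simp [vecArray, direction, mul_comm]

lemma Prepared.isHit_iff (c : ℝ) :
    IsHit (fun i => s.cell 2 i 0) (fun i => s'.cell 3 (s'.idx 10) (m + i)) n c ↔
      ∃ i, c = (1 - coloring n s i) / direction n m s' i ∨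
        c = (-1 - coloring n s i) / direction n m s' i :=
  ⟨fun ⟨i, hi, h⟩ => ⟨⟨i, hi⟩, h⟩, fun ⟨i, h⟩ => ⟨i, i.2, h⟩⟩

lemma Prepared.abs_le_one_hi (h : Prepared n m (vecArray v) s s')
    (hx : ∀ i, |coloring n s i| ≤ 1) (i : Fin n) :
    |coloring n s i + s'.cell 9 0 0 * direction n m s' i| ≤ 1 := by
  have hl := h.limits.congr Prepared.isHit_iff
  refine abs_add_mul_le_one (hx i) (fun hu => ?_) hl.hi_pos (hl.hi_le _ ⟨i, Or.inl rfl⟩)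
    (hl.hi_le _ ⟨i, Or.inr rfl⟩)
  by_contra hi
  exact hu (h.direction_eq_zero i fun h => hi (mem_alive.1 h))

lemma Prepared.abs_le_one_lo (h : Prepared n m (vecArray v) s s')
    (hx : ∀ i, |coloring n s i| ≤ 1) (i : Fin n) :
    |coloring n s i + s'.cell 10 0 0 * direction n m s' i| ≤ 1 := by
  have hl := h.limits.congr Prepared.isHit_iff
  rw [← neg_mul_neg]
  refine abs_add_mul_le_one (hx i) (fun hu => ?_) (neg_pos.2 hl.lo_neg) ?_ ?_
  · by_contra hi
    exact hu (neg_eq_zero.2 (h.direction_eq_zero i fun h => hi (mem_alive.1 h)))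
  · rw [div_neg]
    exact fun h => neg_le_neg (hl.le_lo _ ⟨i, Or.inl rfl⟩ (neg_pos.1 h))
  · rw [div_neg]
    exact fun h => neg_le_neg (hl.le_lo _ ⟨i, Or.inr rfl⟩ (neg_pos.1 h))

lemma Prepared.card_alive_hi (h : Prepared n m (vecArray v) s s')
    (ha : (alive (coloring n s)).Nonempty) :
    (alive fun i => coloring n s i + s'.cell 9 0 0 * direction n m s' i).card <
      (alive (coloring n s)).card := by
  have hl := h.limits.congr Prepared.isHit_iff
  rcases hl.hi_eq with h2 | ⟨i, hi⟩
  · -- The pivot, which moves at unit speed, is hit before the length `2`.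
    have h1 := abs_lt.1 (mem_alive.1 (h.isPivot ha).1)
    have h3 := hl.hi_le _ ⟨⟨s'.idx 10, h.pivot_lt⟩, Or.inl rfl⟩
    rw [(h.isStepDirection ha).pivot, div_one] at h3
    have := h3 (by linarith)
    linarith
  · exact card_alive_lt h.direction_eq_zero hl.hi_pos.ne' hi

lemma Prepared.card_alive_lo (h : Prepared n m (vecArray v) s s')
    (ha : (alive (coloring n s)).Nonempty) :
    (alive fun i => coloring n s i + s'.cell 10 0 0 * direction n m s' i).card <
      (alive (coloring n s)).card := by
  have hl := h.limits.congr Prepared.isHit_iff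
  rcases hl.lo_eq with h2 | ⟨i, hi⟩
  · have h1 := abs_lt.1 (mem_alive.1 (h.isPivot ha).1)
    have h3 := hl.le_lo _ ⟨⟨s'.idx 10, h.pivot_lt⟩, Or.inr rfl⟩
    rw [(h.isStepDirection ha).pivot, div_one] at h3
    have := h3 (by linarith)
    linarith
  · exact card_alive_lt h.direction_eq_zero hl.lo_neg.ne hi

/-- The exponential moment at `θ` of the displacement so far, times the potential of the rest. -/
def weight (v : Fin n → EuclideanSpace ℝ (Fin m)) (x₀ : Fin n → ℝ)
    (θ : EuclideanSpace ℝ (Fin m)) (x : Fin n → ℝ) : ℝ :=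
  Real.exp (inner ℝ θ (∑ i, (x i - x₀ i) • v i)) * potential v θ x

lemma weight_add (x₀ : Fin n → ℝ) (θ : EuclideanSpace ℝ (Fin m)) (x u : Fin n → ℝ) (t : ℝ) :
    weight v x₀ θ (fun i => x i + t * u i) =
      Real.exp (inner ℝ θ (∑ i, (x i - x₀ i) • v i)) *
        (Real.exp (inner ℝ θ (∑ i, (t * u i) • v i)) * potential v θ fun i => x i + t * u i) := by
  rw [weight, ← mul_assoc, ← Real.exp_add, ← inner_add_right, ← Finset.sum_add_distrib]
  simp only [← add_smul]
  congr! 5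
  ring_nf

lemma Prepared.bias_mem (h : Prepared n m (vecArray v) s s') :
    0 ≤ s'.cell 13 0 0 ∧ s'.cell 13 0 0 ≤ 1 ∧
      s'.cell 13 0 0 * s'.cell 9 0 0 + (1 - s'.cell 13 0 0) * s'.cell 10 0 0 = 0 := by
  have h1 := h.limits.hi_pos
  have h2 := h.limits.lo_neg
  have h3 : s'.cell 10 0 0 - s'.cell 9 0 0 < 0 := by linarith
  rw [h.bias]
  refine ⟨div_nonneg_of_nonpos h2.le h3.le, (div_le_one_of_neg h3).2 (by linarith), ?_⟩
  field_simp [h3.ne]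
  ring

lemma Prepared.weight_le (h : Prepared n m (vecArray v) s s') (hv : ∀ i, ‖v i‖ ≤ 1)
    (hx : ∀ i, |coloring n s i| ≤ 1) (x₀ : Fin n → ℝ) (θ : EuclideanSpace ℝ (Fin m)) :
    s'.cell 13 0 0 * weight v x₀ θ
        (fun i => coloring n s i + s'.cell 9 0 0 * direction n m s' i) +
      (1 - s'.cell 13 0 0) * weight v x₀ θ
        (fun i => coloring n s i + s'.cell 10 0 0 * direction n m s' i) ≤
      weight v x₀ θ (coloring n s) := by
  rcases (alive (coloring n s)).eq_empty_or_nonempty with ha | ha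
  · have hu : ∀ i, direction n m s' i = 0 := fun i =>
      h.direction_eq_zero i (ha ▸ Finset.notMem_empty i)
    simp only [hu, mul_zero, add_zero]
    exact le_of_eq (by ring)
  · obtain ⟨h0, h1, hm⟩ := h.bias_mem
    have := potential_step hv θ (h.isPivot ha) (h.isStepDirection ha) h0 h1 hm
      (h.abs_le_one_hi hx) (h.abs_le_one_lo hx)
    rw [weight_add, weight_add, weight]
    have := mul_le_mul_of_nonneg_left this
      (Real.exp_pos (inner ℝ θ (∑ i, (coloring n s i - x₀ i) • v i))).le
    linarith

lemma weight_nonneg (x₀ : Fin n → ℝ) (θ : EuclideanSpace ℝ (Fin m)) {x : Fin n → ℝ}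
    (hx : ∀ i, |x i| ≤ 1) : 0 ≤ weight v x₀ θ x :=
  mul_nonneg (Real.exp_pos _).le (potential_nonneg v θ hx)

/-- The cost of a final memory: the exponential moment at `θ` of the displacement, and `⊤` if the
output is not a coloring by signs. -/
def outputCost (v : Fin n → EuclideanSpace ℝ (Fin m)) (x₀ : Fin n → ℝ)
    (θ : EuclideanSpace ℝ (Fin m)) (s : Memory) : ℝ≥0∞ :=
  open Classical in
  if ∀ i, coloring n s i = -1 ∨ coloring n s i = 1 then
    ENNReal.ofReal (Real.exp (inner ℝ θ (∑ i, (coloring n s i - x₀ i) • v i))) else ⊤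

lemma outputCost_le_weight (x₀ : Fin n → ℝ) (θ : EuclideanSpace ℝ (Fin m))
    (hx : ∀ i, |coloring n s i| ≤ 1) (ha : alive (coloring n s) = ∅) :
    outputCost v x₀ θ s ≤ ENNReal.ofReal (weight v x₀ θ (coloring n s)) := by
  have h1 : ∀ i, coloring n s i = -1 ∨ coloring n s i = 1 := fun i => by
    have h2 : ¬ |coloring n s i| < 1 := fun h => by simpa [ha] using mem_alive.2 h
    exact (eq_or_eq_neg_of_abs_eq (le_antisymm (hx i) (not_lt.1 h2))).symm
  rw [outputCost, if_pos h1]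
  exact ENNReal.ofReal_le_ofReal (le_mul_of_one_le_right (Real.exp_pos _).le
    (one_le_potential_of_alive_eq_empty v θ ha))

lemma expCost_toss (F : Memory → ℝ≥0∞) (T k : ℕ) (x : Ref) (K : List Prog) (s : Memory)
    {q : ℝ} (hx : s.get x = q) (h0 : 0 ≤ q) (h1 : q ≤ 1) :
    expCost F (T + 1) (.toss k x :: K, s) =
      ENNReal.ofReal q * expCost F T (K, s.setIdx k 1) +
        ENNReal.ofReal (1 - q) * expCost F T (K, s.setIdx k 0) := by
  have h : min 1 (ENNReal.ofReal q) = ENNReal.ofReal q :=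
    min_eq_right (ENNReal.ofReal_le_one.2 h1)
  rw [expCost, step, tsum_map_mul, tsum_bool, add_comm, hx]
  simp [coin, PMF.ofFintype_apply, h, ENNReal.ofReal_sub _ h0]

/-- A time bound for one round of the main loop. -/
def roundTime (N : ℕ) : ℕ := 100 * (N + 1) ^ 3 + 8 * N + 12

lemma expCost_walkStep_le {s : Memory} (hE : Env n m (vecArray v) s) (hn : 0 < n)
    (hv : ∀ i, ‖v i‖ ≤ 1) (hx : ∀ i, |coloring n s i| ≤ 1) (x₀ : Fin n → ℝ)
    (θ : EuclideanSpace ℝ (Fin m)) (F : Memory → ℝ≥0∞) (K : List Prog) (T : ℕ)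
    (hK : ∀ s₂, Env n m (vecArray v) s₂ → s₂.idx 5 = s.idx 5 → (∀ i, |coloring n s₂ i| ≤ 1) →
      (alive (coloring n s₂)).card ≤ (alive (coloring n s)).card - 1 →
      expCost F T (K, s₂) ≤ ENNReal.ofReal (weight v x₀ θ (coloring n s₂))) :
    expCost F (T + (100 * (n + m + 1) ^ 3 + 8 * (n + m) + 9)) (walkStep :: K, s) ≤
      ENNReal.ofReal (weight v x₀ θ (coloring n s)) := by
  obtain ⟨s₁, h, hs₁⟩ := (runs_prepare hE hn (by simp +contextual [vecArray])).exists_expCost_le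
  obtain ⟨h0, h1, -⟩ := h.bias_mem
  -- Either outcome of the toss leads, through `move`, to a memory to which `hK` applies.
  have hmove : ∀ b t, (if 0 < b then s₁.cell 9 0 0 else s₁.cell 10 0 0) = t →
      (∀ i, |coloring n s i + t * direction n m s₁ i| ≤ 1) →
      ((alive (coloring n s)).Nonempty → (alive fun i => coloring n s i +
        t * direction n m s₁ i).card < (alive (coloring n s)).card) →
      expCost F (T + (8 * (n + m) + 6)) (move :: K, s₁.setIdx 12 b) ≤
        ENNReal.ofReal (weight v x₀ θ fun i => coloring n s i + t * direction n m s₁ i) := by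
    intro b t hbt hle hcard
    have hA : Agree (.toss 12 (var 13)) s₁ (s₁.setIdx 12 b) := agree_setIdx rfl _ _
    have hE₁ := h.env.of_agree hA rfl
    obtain ⟨s₂, ⟨hA₂, hs₂⟩, hcost⟩ := ((runs_move hE₁).mono (Q' := fun s₂ =>
      Agree move (s₁.setIdx 12 b) s₂ ∧ coloring n s₂ = fun i => coloring n s i +
        t * direction n m s₁ i) le_rfl fun s₂ hA₂ hs₂ => ⟨hA₂, funext fun i => by
          rw [coloring, hs₂ i i.2]
          simp [Memory.setIdx, coloring, direction, h.coloring_eq, hbt]⟩).exists_expCost_le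
    refine (hcost F K T).trans ?_
    rw [← hs₂]
    refine hK s₂ (hE₁.of_agree hA₂ rfl) ?_ (by rwa [hs₂]) ?_
    · rw [hA₂.idx 5 rfl, hA.idx 5 rfl, h.counter]
    · rw [hs₂]
      rcases (alive (coloring n s)).eq_empty_or_nonempty with ha | ha
      · have hu : ∀ i, direction n m s₁ i = 0 := fun i =>
      h.direction_eq_zero i (ha ▸ Finset.notMem_empty i)
        simp [hu, ha]
      · have := hcard ha
        lia
  have hT : T + (100 * (n + m + 1) ^ 3 + 8 * (n + m) + 9) =
      ((T + (8 * (n + m) + 6)) + 1 + 1) + 100 * (n + m + 1) ^ 3 + 1 := by ring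
  rw [hT, walkStep, expCost, step, tsum_pure_mul]
  refine (hs₁ _ _ _).trans ?_
  rw [expCost, step, tsum_pure_mul, expCost_toss (q := s₁.cell 13 0 0) _ _ _ _ _ _
    (by simp [Memory.get, var, h.env.idx3]) h0 h1]
  calc _ ≤ ENNReal.ofReal (s₁.cell 13 0 0) * ENNReal.ofReal _ +
        ENNReal.ofReal (1 - s₁.cell 13 0 0) * ENNReal.ofReal _ :=
        add_le_add
          (mul_le_mul_right (hmove 1 _ (if_pos one_pos) (h.abs_le_one_hi hx) h.card_alive_hi) _)
          (mul_le_mul_right (hmove 0 _ (if_neg (lt_irrefl 0)) (h.abs_le_one_lo hx)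
            h.card_alive_lo) _)
    _ = ENNReal.ofReal _ := by
        rw [← ENNReal.ofReal_mul h0, ← ENNReal.ofReal_mul (sub_nonneg.2 h1), ← ENNReal.ofReal_add
          (mul_nonneg h0 (weight_nonneg x₀ θ (h.abs_le_one_hi hx)))
          (mul_nonneg (sub_nonneg.2 h1) (weight_nonneg x₀ θ (h.abs_le_one_lo hx)))]
    _ ≤ _ := ENNReal.ofReal_le_ofReal (h.weight_le hv hx x₀ θ)

/-- If at most `d` coordinates are alive and `d` rounds of the main loop are left, then the
expected cost of the output is at most the weight of the present coloring. -/
lemma expCost_mainLoop_le (hv : ∀ i, ‖v i‖ ≤ 1) (x₀ : Fin n → ℝ) (θ : EuclideanSpace ℝ (Fin m))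
    (d : ℕ) : ∀ s, Env n m (vecArray v) s → s.idx 5 + d = n → (∀ i, |coloring n s i| ≤ 1) →
      (alive (coloring n s)).card ≤ d →
      expCost (outputCost v x₀ θ) (roundTime (n + m) * d + 1)
        ([.whileDo (.idxLt 5 0) (walkStep ⨟ .idxAdd 5 5 4)], s) ≤
        ENNReal.ofReal (weight v x₀ θ (coloring n s)) := by
  induction d with
  | zero =>
    intro s hE hd hx ha
    have hc : ¬ Test.Holds s (.idxLt 5 0) := by
      simp only [Test.Holds, hE.idx0]
      lia
    rw [expCost, step, tsum_pure_mul, if_neg hc, expCost_nil]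
    exact outputCost_le_weight x₀ θ hx (Finset.card_eq_zero.1 (Nat.le_zero.1 ha))
  | succ d ih =>
    intro s hE hd hx ha
    have hc : Test.Holds s (.idxLt 5 0) := by
      simp only [Test.Holds, hE.idx0]
      lia
    have hT : roundTime (n + m) * (d + 1) + 1 = ((roundTime (n + m) * d + 1 + 1) +
        (100 * (n + m + 1) ^ 3 + 8 * (n + m) + 9)) + 1 + 1 := by
      rw [roundTime]
      ring
    rw [hT, expCost, step, tsum_pure_mul, if_pos hc, expCost, step, tsum_pure_mul]
    refine expCost_walkStep_le hE (by lia) hv hx x₀ θ _ _ _ fun s₂ hE₂ h5 hx₂ ha₂ => ?_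
    rw [expCost, step, tsum_pure_mul]
    refine ih _ (hE₂.of_agree (agree_setIdx (a := .idxAdd 5 5 4) rfl _ _) rfl) ?_ hx₂
      (ha₂.trans (by lia))
    simp only [Memory.setIdx, Function.update_self, h5, hE₂.idx4]
    lia

/-- A time bound for the whole program. -/
def walkTime : Polynomial ℕ :=
  (100 * (Polynomial.X + 1) ^ 3 + 8 * Polynomial.X + 12) * Polynomial.X + 4 * Polynomial.X + 15

lemma expCost_walk_le (hv : ∀ i, ‖v i‖ ≤ 1) {x₀ : Fin n → ℝ}
    (hx₀ : ∀ i, x₀ i ∈ Set.Icc (-1 : ℝ) 1) (θ : EuclideanSpace ℝ (Fin m)) :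
    expCost (outputCost v x₀ θ) (walkTime.eval (n + m)) ([walk], initial v x₀) ≤
      ENNReal.ofReal (Real.exp (20 * ‖θ‖ ^ 2)) := by
  have hinit : (initial v x₀).cell 0 = vecArray v := by
    funext i j
    simp [initial, vecArray]
  obtain ⟨s₁, ⟨hE, hs₁⟩, hcost⟩ := (runs_setup (n := n) (m := m) (s := initial v x₀) rfl rfl rfl
    rfl).exists_expCost_le
  rw [hinit] at hE
  have hcol : coloring n s₁ = x₀ := by
    funext i
    rw [coloring, hs₁ i i.2]
    simp [initial]
  have hx : ∀ i, |x₀ i| ≤ 1 := fun i => abs_le.2 (hx₀ i)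
  have hT : (roundTime (n + m) * n + 1 + 1 + 1) + (4 * (n + m) + 11) + 1 ≤
      walkTime.eval (n + m) := by
    simp only [walkTime, Polynomial.eval_add, Polynomial.eval_mul, Polynomial.eval_pow,
      Polynomial.eval_X, Polynomial.eval_ofNat, Polynomial.eval_one]
    have : roundTime (n + m) * n ≤ roundTime (n + m) * (n + m) := by gcongr; lia
    rw [roundTime] at this ⊢
    lia
  refine (expCost_antitone _ _ hT).trans ?_
  beta_reduce
  rw [walk, expCost, step, tsum_pure_mul]
  refine (hcost _ _ _).trans ?_
  rw [forDo, expCost, step, tsum_pure_mul, expCost, step, tsum_pure_mul]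
  refine (expCost_mainLoop_le hv x₀ θ n _
    (hE.of_agree (agree_setIdx (a := .idxConst 5 0) rfl s₁ 0) rfl) (by simp [Memory.setIdx])
    (by rw [show coloring n (s₁.setIdx 5 0) = x₀ from hcol]; exact hx)
    ((Finset.card_le_univ _).trans (by simp))).trans ?_
  rw [show coloring n (s₁.setIdx 5 0) = x₀ from hcol]
  refine ENNReal.ofReal_le_ofReal ?_
  rw [weight]
  simp only [sub_self, zero_smul, Finset.sum_const_zero, inner_zero_right, Real.exp_zero, one_mul]
  refine (potential_le v θ hx).trans (Real.exp_le_exp.2 ?_)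
  gcongr
  exact energy_le _ θ

/-! ### The output law -/

lemma lintegral_toMeasure {α : Type*} [MeasurableSpace α] [MeasurableSingletonClass α] (μ : PMF α)
    (f : α → ℝ≥0∞) : ∫⁻ a, f a ∂μ.toMeasure = ∑' a, μ a * f a := by
  rw [← μ.restrict_toMeasure_support, lintegral_countable f μ.support_countable,
    ← tsum_subtype_eq_of_support_subset (s := μ.support)]
  · refine tsum_congr fun a => ?_
    rw [μ.toMeasure_apply_singleton a (measurableSet_singleton _), mul_comm]
  · exact fun a ha => fun h => ha (by simp [h])

end Walk
end GramSchmidtWalk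
end

open GramSchmidtWalk in
theorem theorem3 :
    ∃ (A : RealRAM.Prog) (p : Polynomial ℕ),
      ∀ (n m : ℕ) (v : Fin n → EuclideanSpace ℝ (Fin m)) (x₀ : Fin n → ℝ),
        (∀ i, ‖v i‖ ≤ 1) → (∀ i, x₀ i ∈ Set.Icc (-1 : ℝ) 1) →
          RealRAM.HaltsWithin A v x₀ (p.eval (n + m)) ∧
          (∀ x ∈ (RealRAM.outputLaw A v x₀ (p.eval (n + m))).support, ∀ i, x i = -1 ∨ x i = 1) ∧
          IsSubgaussian (fun x : Fin n → ℝ => ∑ i, (x i - x₀ i) • v i) (Real.sqrt 40)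
            (RealRAM.outputLaw A v x₀ (p.eval (n + m))).toMeasure := by
  refine ⟨walk, walkTime, fun n m v x₀ hv hx₀ => ?_⟩
  set T := walkTime.eval (n + m)
  have hcost : ∀ θ, ∑' c, RealRAM.runOn walk v x₀ T c * RealRAM.expCost (outputCost v x₀ θ) 0 c ≤
      ENNReal.ofReal (Real.exp (20 * ‖θ‖ ^ 2)) := fun θ => by
    rw [RealRAM.runOn, ← RealRAM.expCost_eq_tsum]
    exact expCost_walk_le hv hx₀ θ
  have hfin : ∀ c ∈ (RealRAM.runOn walk v x₀ T).support,
      RealRAM.expCost (outputCost v x₀ 0) 0 c ≠ ⊤ := by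
    intro c hc htop
    have h1 := (ENNReal.le_tsum c).trans (hcost 0)
    rw [htop, ENNReal.mul_top (by exact hc)] at h1
    exact ENNReal.ofReal_ne_top (top_le_iff.1 h1)
  refine ⟨?_, ?_, fun θ => ?_⟩
  · rintro ⟨_ | ⟨a, K⟩, s⟩ hc
    · rfl
    · exact absurd rfl (hfin _ hc)
  · intro x hx
    obtain ⟨⟨_ | ⟨a, K⟩, s⟩, hc, rfl⟩ := (PMF.mem_support_map_iff _ _ _).1 hx
    · by_contra h
      exact hfin _ hc (if_neg h)
    · exact absurd rfl (hfin _ hc)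
  · have hmeas : Continuous fun x : Fin n → ℝ =>
        Real.exp (inner ℝ θ (∑ i, (x i - x₀ i) • v i)) := by fun_prop
    have hle : ∫⁻ x, ENNReal.ofReal (Real.exp (inner ℝ θ (∑ i, (x i - x₀ i) • v i)))
        ∂(RealRAM.outputLaw walk v x₀ T).toMeasure ≤
        ENNReal.ofReal (Real.exp (20 * ‖θ‖ ^ 2)) := by
      rw [lintegral_toMeasure, RealRAM.outputLaw, RealRAM.tsum_map_mul]
      refine (ENNReal.tsum_le_tsum fun c => mul_le_mul_right ?_ _).trans (hcost θ)
      obtain ⟨_ | ⟨a, K⟩, s⟩ := c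
      · rw [RealRAM.expCost, outputCost]
        split_ifs
        · exact le_rfl
        · exact le_top
      · exact le_top
    have hσ : Real.sqrt 40 ^ 2 / 2 = 20 := by
      rw [Real.sq_sqrt (by norm_num)]
      norm_num
    rw [hσ]
    refine ⟨⟨hmeas.aestronglyMeasurable, ?_⟩, ?_⟩
    · rw [hasFiniteIntegral_iff_ofReal (.of_forall fun _ => (Real.exp_pos _).le)]
      exact hle.trans_lt ENNReal.ofReal_lt_top
    · rw [integral_eq_lintegral_of_nonneg_ae (.of_forall fun _ => (Real.exp_pos _).le)
        hmeas.aestronglyMeasurable]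
      exact ENNReal.toReal_le_of_le_ofReal (Real.exp_pos _).le hle
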